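/- Let $n\ge 2$, $1<p<\infty$, let $B_1\subset\mathbb R^n$ be the open unit ball, $Q_1^+=B_1\times(0,1)$ and $\Delta_p w=\operatorname{div}(|\nabla w|^{p-2}\nabla w)$. Let $\phi$ be continuous in $Q_1^+$, let $f$ be a function on $\partial B_1\times(0,1)$ and $g$ a function on $B_1$. Let $u$ be a solution of the $p$-parabolic obstacle problem in $Q_1^+$ with obstacle $\phi$, lateral boundary datum $f$ and initial datum $g$, that is, of $$\max(\Delta_p u-u_t,\ \phi-u)=0\ \text{ in } Q_1^+,\qquad u=f\ \text{ on }\partial B_1\times(0,1),\qquad u(\cdot,0)=g\ \text{ on } B_1,$$ in the following sense: $u$ is continuous on $\overline{B_1}\times[0,1)$ and attains the data $f$ and $g$ pointwise; $u\in L^p_{\rm loc}(Q_1^+)$ has a weak spatial gradient $\nabla u\in L^p_{\rm loc}(Q_1^+)$; $u\ge\phi$ in $Q_1^+$; $\iint (|\nabla u|^{p-2}\nabla u\cdot\nabla\psi-u\,\psi_t)\,dx\,dt\ge 0$ for all $0\le\psi\in C_c^\infty(Q_1^+)$; and equality holds for all $\psi\in C_c^\infty(\{(x,t)\in Q_1^+: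 u(x,t)>\phi(x,t)\})$. Suppose that for some constant $N>0$ we have $|f_t|\le N$ on $\partial B_1\times(0,1)$ and $|\phi_t|\le N$ in $Q_1^+$, in the sense that $f(x,\cdot)$ (for $x\in\partial B_1$) and $\phi(x,\cdot)$ (for $x\in B_1$) are Lipschitz on $(0,1)$ with constant $N$, and that $|\Delta_p g|\le N$ in $B_1$, in the sense that $g\in W^{1,p}_{\rm loc}(B_1)$ and the distribution $\Delta_p g$ is a measurable function bounded by $N$ almost everywhere. Then $$|u_t|\le N\quad\text{in } Q_1^+ :$$ $|u(x,t)-u(x,s)|\le N|t-s|$ for all $x\in B_1$ and $s,t\in[0,1)$, and for every $x\in B_1$ the derivative $u_t(x,t)$ exists and satisfies $|u_t(x,t)|\le N$ for almost every $t\in(0,1)$. -/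

import Mathlib

open MeasureTheory

noncomputable section

namespace PObstacle

/-- The vector field `v ↦ |v|^{p-2} v` (equal to `0` at `v = 0`), so that
`Δ_p w = div (pFlux p (∇ w))`. -/
def pFlux {n : ℕ} (p : ℝ) (v : EuclideanSpace ℝ (Fin n)) : EuclideanSpace ℝ (Fin n) :=
  ‖v‖ ^ (p - 2) • v

/-- `ψ ∈ C_c^∞(O)`. -/
structure IsTestFunction {V : Type*} [NormedAddCommGroup V] [NormedSpace ℝ V]
    (O : Set V) (ψ : V → ℝ) : Prop where
  smooth : ContDiff ℝ ((⊤ : ℕ∞) : WithTop ℕ∞) ψ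
  compact_support : HasCompactSupport ψ
  support_subset : tsupport ψ ⊆ O

/-- `w ∈ L^p_loc(O)`. -/
def MemLpLoc {V F : Type*} [TopologicalSpace V] [MeasureSpace V] [NormedAddCommGroup F]
    (p : ℝ) (O : Set V) (w : V → F) : Prop :=
  ∀ K : Set V, K ⊆ O → IsCompact K → MemLp w (ENNReal.ofReal p) (volume.restrict K)

/-! ### The stationary operator -/

/-- `w ∈ W^{1,p}_loc(O)` with weak gradient `G`, for an open set `O` of `ℝⁿ`. -/
structure HasWeakGrad {n : ℕ} (p : ℝ) (O : Set (EuclideanSpace ℝ (Fin n)))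
    (w : EuclideanSpace ℝ (Fin n) → ℝ)
    (G : EuclideanSpace ℝ (Fin n) → EuclideanSpace ℝ (Fin n)) : Prop where
  memLp : MemLpLoc p O w
  grad_memLp : MemLpLoc p O G
  integral_eq : ∀ ψ, IsTestFunction O ψ → ∀ e : EuclideanSpace ℝ (Fin n),
    ∫ x in O, w x * fderiv ℝ ψ x e = - ∫ x in O, inner ℝ (G x) e * ψ x

/-- `|Δ_p w| ≤ N` in the open set `O`: the function `w` is in `W^{1,p}_loc(O)`, and the
distribution `Δ_p w = div (|∇w|^{p-2} ∇w)` is a measurable function `H` with `|H| ≤ N` a.e. -/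
def PLaplacianAbsLe {n : ℕ} (p N : ℝ) (O : Set (EuclideanSpace ℝ (Fin n)))
    (w : EuclideanSpace ℝ (Fin n) → ℝ) : Prop :=
  ∃ (G : EuclideanSpace ℝ (Fin n) → EuclideanSpace ℝ (Fin n))
    (H : EuclideanSpace ℝ (Fin n) → ℝ),
    HasWeakGrad p O w G ∧
    AEStronglyMeasurable H (volume.restrict O) ∧
    (∀ᵐ x ∂(volume.restrict O), |H x| ≤ N) ∧
    ∀ ψ, IsTestFunction O ψ →
      ∫ x in O, fderiv ℝ ψ x (pFlux p (G x)) = - ∫ x in O, H x * ψ x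

/-! ### The evolutionary operator; points of space-time are pairs `z = (x, t)` -/

/-- `w` is in `L^p_loc(O)` and has the weak spatial gradient `G ∈ L^p_loc(O)`, for an open set
`O` of space-time. Here `fderiv ℝ ψ z (e, 0)` is the spatial derivative `∇ψ · e`. -/
structure HasWeakSpatialGrad {n : ℕ} (p : ℝ) (O : Set (EuclideanSpace ℝ (Fin n) × ℝ))
    (w : EuclideanSpace ℝ (Fin n) × ℝ → ℝ)
    (G : EuclideanSpace ℝ (Fin n) × ℝ → EuclideanSpace ℝ (Fin n)) : Prop where
  memLp : MemLpLoc p O w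
  grad_memLp : MemLpLoc p O G
  integral_eq : ∀ ψ, IsTestFunction O ψ → ∀ e : EuclideanSpace ℝ (Fin n),
    ∫ z in O, w z * fderiv ℝ ψ z (e, 0) = - ∫ z in O, inner ℝ (G z) e * ψ z

/-- The weak form `∫∫_O (|G|^{p-2} G · ∇ψ - w ψ_t) dx dt` of `w_t - Δ_p w`, where `G` is the
weak spatial gradient of `w`. -/
def weakForm {n : ℕ} (p : ℝ) (O : Set (EuclideanSpace ℝ (Fin n) × ℝ))
    (w : EuclideanSpace ℝ (Fin n) × ℝ → ℝ)
    (G : EuclideanSpace ℝ (Fin n) × ℝ → EuclideanSpace ℝ (Fin n))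
    (ψ : EuclideanSpace ℝ (Fin n) × ℝ → ℝ) : ℝ :=
  ∫ z in O, (fderiv ℝ ψ z (pFlux p (G z), 0) - w z * fderiv ℝ ψ z (0, 1))

/-- `Δ_p w - w_t ≤ 0` weakly in the open set `O`. -/
def IsWeakSupersolution {n : ℕ} (p : ℝ) (O : Set (EuclideanSpace ℝ (Fin n) × ℝ))
    (w : EuclideanSpace ℝ (Fin n) × ℝ → ℝ) : Prop :=
  ∃ G, HasWeakSpatialGrad p O w G ∧
    ∀ ψ, IsTestFunction O ψ → (∀ z, 0 ≤ ψ z) → 0 ≤ weakForm p O w G ψ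

/-- `Δ_p w - w_t = 0` weakly in the open set `O`. -/
def IsWeakSolution {n : ℕ} (p : ℝ) (O : Set (EuclideanSpace ℝ (Fin n) × ℝ))
    (w : EuclideanSpace ℝ (Fin n) × ℝ → ℝ) : Prop :=
  ∃ G, HasWeakSpatialGrad p O w G ∧
    ∀ ψ, IsTestFunction O ψ → weakForm p O w G ψ = 0

/-- The open unit cylinder `B₁ × (0, 1)`. -/
def cylinder (n : ℕ) : Set (EuclideanSpace ℝ (Fin n) × ℝ) :=
  Metric.ball 0 1 ×ˢ Set.Ioo 0 1

/-- `u` solves the `p`-parabolic obstacle problem `max (Δ_p u - u_t, φ - u) = 0` in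
`B₁ × (0, 1)` with obstacle `φ`, lateral boundary datum `f` on `∂B₁ × (0, 1)`, and initial
datum `g` on `B₁` at time `0`. -/
structure IsObstacleSolution {n : ℕ} (p : ℝ)
    (φ f : EuclideanSpace ℝ (Fin n) × ℝ → ℝ) (g : EuclideanSpace ℝ (Fin n) → ℝ)
    (u : EuclideanSpace ℝ (Fin n) × ℝ → ℝ) : Prop where
  continuousOn : ContinuousOn u (Metric.closedBall 0 1 ×ˢ Set.Ico 0 1)
  obstacle_le : ∀ z ∈ cylinder n, φ z ≤ u z
  supersolution : IsWeakSupersolution p (cylinder n) u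
  solution_off_contact : IsWeakSolution p {z ∈ cylinder n | φ z < u z} u
  lateral : ∀ x ∈ Metric.sphere (0 : EuclideanSpace ℝ (Fin n)) 1, ∀ t ∈ Set.Ioo (0 : ℝ) 1,
    u (x, t) = f (x, t)
  initial : ∀ x ∈ Metric.ball (0 : EuclideanSpace ℝ (Fin n)) 1, u (x, 0) = g x

/-- `|w_t| ≤ N` on `S × I` (`I` an interval), in the sense of Lipschitz functions of time. -/
def TimeDerivAbsLe {n : ℕ} (N : ℝ) (S : Set (EuclideanSpace ℝ (Fin n))) (I : Set ℝ)
    (w : EuclideanSpace ℝ (Fin n) × ℝ → ℝ) : Prop :=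
  ∀ x ∈ S, ∀ s ∈ I, ∀ t ∈ I, |w (x, t) - w (x, s)| ≤ N * |t - s|

end PObstacle

end

/-! The equation is invariant under translation in time and under addition of constants, so the
bound follows from comparing `u` with its translate `u(·, · + h) ± N h`. The obstacle does not
interfere, because the comparison takes place only where the order is violated. If `u(x, t + h) - N
h > u(x, t)`, then `u(x, t) ≥ φ(x, t) ≥ φ(x, t + h) - N h`, so `u > φ` at the translated point and
the translate is a genuine solution there. The other function is a supersolution everywhere. The
reverse inequality is symmetric. On the lateral boundary the order comes from the Lipschitz bound on
`f`. At time `0` it comes from a preliminary comparison of `u` with the barriers `u(x, 0) ± N t`, a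
super- and a subsolution because `|Δ_p g| ≤ N`. These steps are
`IsObstacleSolution.abs_translate_sub_le` and `IsObstacleSolution.abs_sub_initial_le`.

The analytic core is `comparison`, for a subsolution `w` and a supersolution `v` on the open set `{v
< w}`. Formally, one tests the difference of the two inequalities with a convex truncation of `w -
v` times a decreasing function of time. Monotonicity of `ξ ↦ |ξ|^{p-2} ξ` gives the elliptic term a
sign, and what remains forces the truncation to vanish. Since `w - v` has no time derivative in a
function space, everything is mollified in space-time. The distributional inequality then holds
pointwise, the computation is classical (`IsWeakSubflow.integral_mollify_le`), and the limit
(`IsWeakSubflow.integral_nonneg`) needs only `L^1` convergence of the products of fluxes and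
gradients, which are in conjugate Lebesgue spaces. Truncating above a level `ε > 0` keeps all
supports compact inside `{v < w}`, so no boundary regularity beyond continuity enters. -/

open Filter Topology Metric ENNReal

set_option linter.unusedSectionVars false

noncomputable section

namespace PObstacle

/-! ### Mollification and its convergence in `L^p` -/

section Mollification

variable {E : Type*} [NormedAddCommGroup E] [NormedSpace ℝ E] [FiniteDimensional ℝ E]
  [MeasurableSpace E] [BorelSpace E]

/-- The mollification of `f` by the normalized bump function `ρ`. -/
def mollify (μ : Measure E) (ρ : ContDiffBump (0 : E)) (f : E → ℝ) : E → ℝ :=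
  convolution (ρ.normed μ) f (ContinuousLinearMap.lsmul ℝ ℝ) μ

/-- A sequence of bump functions with radii tending to zero. -/
def bumpSeq (k : ℕ) : ContDiffBump (0 : E) where
  rIn := 1 / (2 * ((k : ℝ) + 1))
  rOut := 1 / ((k : ℝ) + 1)
  rIn_pos := by positivity
  rIn_lt_rOut := by
    apply one_div_lt_one_div_of_lt <;> nlinarith [Nat.cast_nonneg (α := ℝ) k]

theorem tendsto_bumpSeq_rOut :
    Tendsto (fun k => (bumpSeq k : ContDiffBump (0 : E)).rOut) atTop (𝓝 0) :=
  tendsto_one_div_add_atTop_nhds_zero_nat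

variable {μ : Measure E} [μ.IsAddHaarMeasure] (ρ : ContDiffBump (0 : E)) {f : E → ℝ}

theorem mollify_apply (x : E) : mollify μ ρ f x = ∫ y, ρ.normed μ y * f (x - y) ∂μ := rfl

theorem mollify_apply' (x : E) : mollify μ ρ f x = ∫ y, ρ.normed μ (x - y) * f y ∂μ := by
  rw [mollify, convolution_lsmul_swap]; rfl

theorem contDiff_mollify (hf : LocallyIntegrable f μ) : ContDiff ℝ 1 (mollify μ ρ f) :=
  ρ.hasCompactSupport_normed.contDiff_convolution_left (n := 1) _ ρ.contDiff_normed hf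

theorem fderiv_mollify (hf : LocallyIntegrable f μ) (x e : E) :
    fderiv ℝ (mollify μ ρ f) x e = ∫ y, f y * fderiv ℝ (ρ.normed μ) (x - y) e ∂μ := by
  have h1 := (ρ.hasCompactSupport_normed (μ := μ)).hasFDerivAt_convolution_left
    (ContinuousLinearMap.lsmul ℝ ℝ) ρ.contDiff_normed hf x
  have hint : ConvolutionExistsAt (fderiv ℝ (ρ.normed μ)) f x
      ((ContinuousLinearMap.lsmul ℝ ℝ : ℝ →L[ℝ] ℝ →L[ℝ] ℝ).precompL E) μ :=
    (ρ.hasCompactSupport_normed.fderiv ℝ).convolutionExists_left _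
      ((ρ.contDiff_normed (n := 1)).continuous_fderiv (by norm_num)) hf x
  have h2 : fderiv ℝ (mollify μ ρ f) x = _ := h1.fderiv
  rw [h2, convolution_def, ContinuousLinearMap.integral_apply hint]
  rw [← integral_sub_left_eq_self _ μ x]
  simp [ContinuousLinearMap.precompL_apply, mul_comm]

theorem fderiv_comp_sub_left {η : E → ℝ} (hη : Differentiable ℝ η) (x y e : E) :
    fderiv ℝ (fun z => η (x - z)) y e = - fderiv ℝ η (x - y) e := by
  have h := (hη (x - y)).hasFDerivAt.comp y ((hasFDerivAt_id y).const_sub x)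
  rw [show (fun z => η (x - z)) = η ∘ HSub.hSub x from rfl, h.fderiv]
  simp

theorem abs_mollify_le {M : ℝ} (hM : ∀ x, |f x| ≤ M) (x : E) : |mollify μ ρ f x| ≤ M := by
  rw [mollify_apply]
  calc |∫ y, ρ.normed μ y * f (x - y) ∂μ| ≤ ∫ y, ρ.normed μ y * M ∂μ := by
        refine norm_integral_le_of_norm_le (f := fun y => ρ.normed μ y * f (x - y)) ?_
          (.of_forall fun y => ?_)
        · exact ρ.integrable_normed.mul_const _
        · rw [Real.norm_eq_abs, abs_mul, abs_of_nonneg (ρ.nonneg_normed y)]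
          gcongr
          · exact ρ.nonneg_normed y
          · exact hM _
    _ = M := by rw [integral_mul_const, ρ.integral_normed, one_mul]

/-- A mollification is an average over a ball of radius `rOut`, so only an upper bound on that ball
matters. The global bound `M` serves integrability alone. -/
theorem mollify_le {M c : ℝ} (hfm : AEStronglyMeasurable f μ) (hM : ∀ x, |f x| ≤ M) (x : E)
    (hc : ∀ y ∈ ball x ρ.rOut, f y ≤ c) : mollify μ ρ f x ≤ c := by
  rw [mollify_apply]
  calc ∫ y, ρ.normed μ y * f (x - y) ∂μ ≤ ∫ y, ρ.normed μ y * c ∂μ := by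
        refine integral_mono ?_ (ρ.integrable_normed.mul_const _) fun y => ?_
        · refine ρ.integrable_normed.mul_bdd (c := M) ?_ (.of_forall fun y => hM _)
          exact hfm.comp_quasiMeasurePreserving
            (quasiMeasurePreserving_sub_left_of_right_invariant μ x)
        · dsimp only
          by_cases hy : y ∈ ball (0 : E) ρ.rOut
          · refine mul_le_mul_of_nonneg_left (hc _ ?_) (ρ.nonneg_normed y)
            simpa [mem_ball, dist_eq_norm] using hy
          · rw [← ρ.support_normed_eq (μ := μ), Function.notMem_support] at hy
            simp [hy]
    _ = c := by rw [integral_mul_const, ρ.integral_normed, one_mul]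

/-- Continuity of translations in `L^p`. -/
theorem exists_forall_eLpNorm_translate_sub_le {p : ℝ≥0∞} (hp1 : 1 ≤ p) (hp : p ≠ ∞)
    (hf : MemLp f p μ) {ε : ℝ≥0∞} (hε : 0 < ε) :
    ∃ δ > 0, ∀ y : E, ‖y‖ < δ → eLpNorm (fun x => f (x - y) - f x) p μ ≤ ε := by
  have : Fact (1 ≤ p) := ⟨hp1⟩
  have : Fact (p ≠ ∞) := ⟨hp⟩
  have hcont : Continuous fun y : E => DomAddAct.mk (-y) +ᵥ hf.toLp f :=
    (DomAddAct.mkHomeomorph.continuous.comp continuous_neg).vadd continuous_const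
  have ht := EMetric.tendsto_nhds.1 (hcont.tendsto 0) ε hε
  obtain ⟨δ, hδ, h⟩ := Metric.eventually_nhds_iff.1 ht
  refine ⟨δ, hδ, fun y hy => ?_⟩
  have := h (y := y) (by simpa using hy)
  rw [DomAddAct.mk_vadd_toLp, DomAddAct.mk_vadd_toLp, Lp.edist_toLp_toLp] at this
  refine le_of_eq_of_le (congrArg (fun g => eLpNorm g p μ) ?_) this.le
  ext x
  simp [vadd_eq_add, sub_eq_neg_add]

/-- Jensen's inequality: `ρ.normed μ` is the density of a probability measure, for which the `L^1`
norm is at most the `L^p` norm. -/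
theorem enorm_mollify_sub_rpow_le {p : ℝ≥0∞} (hp1 : 1 ≤ p) (hp : p ≠ ∞)
    (hf : LocallyIntegrable f μ) (x : E) :
    ‖mollify μ ρ f x - f x‖ₑ ^ p.toReal ≤
      ∫⁻ y, ‖f (x - y) - f x‖ₑ ^ p.toReal
        ∂(μ.withDensity fun y => ENNReal.ofReal (ρ.normed μ y)) := by
  set ν := μ.withDensity fun y => ENNReal.ofReal (ρ.normed μ y) with hν
  have hρm : Measurable fun y => ENNReal.ofReal (ρ.normed μ y) :=
    (ρ.continuous_normed.measurable).ennreal_ofReal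
  have hνp : IsProbabilityMeasure ν := by
    refine ⟨?_⟩
    rw [hν, withDensity_apply _ MeasurableSet.univ, Measure.restrict_univ,
      ← ofReal_integral_eq_lintegral_ofReal ρ.integrable_normed (.of_forall ρ.nonneg_normed),
      ρ.integral_normed, ENNReal.ofReal_one]
  have hp0 : p ≠ 0 := (zero_lt_one.trans_le hp1).ne'
  have hm : AEStronglyMeasurable (fun y => f (x - y) - f x) μ :=
    (hf.aestronglyMeasurable.comp_quasiMeasurePreserving
      (quasiMeasurePreserving_sub_left_of_right_invariant μ x)).sub aestronglyMeasurable_const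
  have hmν : AEStronglyMeasurable (fun y => f (x - y) - f x) ν :=
    hm.mono_ac (withDensity_absolutelyContinuous _ _)
  have hint : Integrable (fun y => ρ.normed μ y * f (x - y)) μ :=
    ρ.hasCompactSupport_normed.convolutionExists_left (ContinuousLinearMap.lsmul ℝ ℝ)
      ρ.continuous_normed hf x
  have heq : mollify μ ρ f x - f x = ∫ y, ρ.normed μ y * (f (x - y) - f x) ∂μ := by
    simp_rw [mul_sub]
    rw [integral_sub hint (ρ.integrable_normed.mul_const _), integral_mul_const,
      ρ.integral_normed, one_mul, mollify_apply]
  have h1 : ‖mollify μ ρ f x - f x‖ₑ ≤ eLpNorm (fun y => f (x - y) - f x) 1 ν := by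
    rw [heq, eLpNorm_one_eq_lintegral_enorm, hν,
      lintegral_withDensity_eq_lintegral_mul₀ hρm.aemeasurable hm.enorm]
    refine (enorm_integral_le_lintegral_enorm _).trans_eq (lintegral_congr fun y => ?_)
    rw [enorm_mul, Pi.mul_apply, Real.enorm_eq_ofReal (ρ.nonneg_normed y)]
  have h2 := h1.trans (eLpNorm_le_eLpNorm_of_exponent_le hp1 hmν)
  rw [eLpNorm_eq_lintegral_rpow_enorm_toReal hp0 hp] at h2
  have hpos : 0 < p.toReal := ENNReal.toReal_pos hp0 hp
  calc _ ≤ _ := ENNReal.rpow_le_rpow h2 hpos.le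
    _ = _ := by rw [← ENNReal.rpow_mul, one_div_mul_cancel hpos.ne', ENNReal.rpow_one]

/-- Integrate the pointwise Jensen bound in `x` and exchange integrals by Tonelli: the mollification
error becomes an average of translation errors over shifts shorter than `rOut`. -/
theorem eLpNorm_mollify_sub_le {p : ℝ≥0∞} (hp1 : 1 ≤ p) (hp : p ≠ ∞)
    (hf : LocallyIntegrable f μ) {ε : ℝ≥0∞}
    (h : ∀ y : E, ‖y‖ < ρ.rOut → eLpNorm (fun x => f (x - y) - f x) p μ ≤ ε) :
    eLpNorm (fun x => mollify μ ρ f x - f x) p μ ≤ ε := by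
  set ν := μ.withDensity fun y => ENNReal.ofReal (ρ.normed μ y) with hν
  have hρm : Measurable fun y => ENNReal.ofReal (ρ.normed μ y) :=
    (ρ.continuous_normed.measurable).ennreal_ofReal
  have hνuniv : ν Set.univ = 1 := by
    rw [hν, withDensity_apply _ MeasurableSet.univ, Measure.restrict_univ,
      ← ofReal_integral_eq_lintegral_ofReal ρ.integrable_normed (.of_forall ρ.nonneg_normed),
      ρ.integral_normed, ENNReal.ofReal_one]
  have : IsFiniteMeasure ν := ⟨by rw [hνuniv]; exact ENNReal.one_lt_top⟩
  have hp0 : p ≠ 0 := (zero_lt_one.trans_le hp1).ne'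
  have hpos : 0 < p.toReal := ENNReal.toReal_pos hp0 hp
  have hνac : ν ≪ μ := withDensity_absolutelyContinuous _ _
  have hm : AEStronglyMeasurable (fun z : E × E => f (z.1 - z.2) - f z.1) (μ.prod ν) :=
    ((hf.aestronglyMeasurable.comp_quasiMeasurePreserving
      (quasiMeasurePreserving_sub_of_right_invariant μ μ)).sub
      hf.aestronglyMeasurable.comp_fst).mono_ac (Measure.AbsolutelyContinuous.rfl.prod hνac)
  have hsupp : ∀ᵐ y ∂ν, ‖y‖ < ρ.rOut := by
    rw [hν, ae_withDensity_iff hρm]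
    refine .of_forall fun y hy => ?_
    have : y ∈ Function.support (ρ.normed μ) := fun h0 => hy (by rw [h0, ENNReal.ofReal_zero])
    rw [ρ.support_normed_eq] at this
    simpa using this
  rw [eLpNorm_eq_lintegral_rpow_enorm_toReal hp0 hp, one_div, ENNReal.rpow_inv_le_iff hpos]
  calc ∫⁻ x, ‖mollify μ ρ f x - f x‖ₑ ^ p.toReal ∂μ
      ≤ ∫⁻ x, ∫⁻ y, ‖f (x - y) - f x‖ₑ ^ p.toReal ∂ν ∂μ :=
        lintegral_mono fun x => enorm_mollify_sub_rpow_le ρ hp1 hp hf x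
    _ = ∫⁻ y, ∫⁻ x, ‖f (x - y) - f x‖ₑ ^ p.toReal ∂μ ∂ν :=
        lintegral_lintegral_swap (hm.enorm.pow_const _)
    _ ≤ ∫⁻ _, ε ^ p.toReal ∂ν := by
        refine lintegral_mono_ae (hsupp.mono fun y hy => ?_)
        rw [← ENNReal.rpow_inv_le_iff hpos, ← one_div,
          ← eLpNorm_eq_lintegral_rpow_enorm_toReal hp0 hp]
        exact h y hy
    _ = ε ^ p.toReal := by rw [lintegral_const, hνuniv, mul_one]

/-- Mollifications of an `L^p` function converge in `L^p`. -/
theorem tendsto_eLpNorm_mollify_sub {p : ℝ≥0∞} (hp1 : 1 ≤ p) (hp : p ≠ ∞) (hf : MemLp f p μ) :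
    Tendsto (fun k => eLpNorm (fun x => mollify μ (bumpSeq k) f x - f x) p μ) atTop (𝓝 0) := by
  rw [ENNReal.tendsto_nhds_zero]
  intro ε hε
  obtain ⟨δ, hδ, h⟩ := exists_forall_eLpNorm_translate_sub_le hp1 hp hf hε
  filter_upwards [(tendsto_order.1 (tendsto_bumpSeq_rOut (E := E))).2 δ hδ] with k hk
  exact eLpNorm_mollify_sub_le _ hp1 hp (hf.locallyIntegrable hp1) fun y hy => h y (hy.trans hk)

theorem ae_tendsto_mollify (hf : LocallyIntegrable f μ) :
    ∀ᵐ x ∂μ, Tendsto (fun k => mollify μ (bumpSeq k) f x) atTop (𝓝 (f x)) := by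
  -- `K = 2` is the ratio `rOut / rIn` in `bumpSeq`; its boundedness is what Lebesgue
  -- differentiation requires.
  refine ContDiffBump.ae_convolution_tendsto_right_of_locallyIntegrable
    (φ := fun k => (bumpSeq k : ContDiffBump (0 : E))) (K := 2)
    tendsto_bumpSeq_rOut (.of_forall fun k => ?_) hf
  simp only [bumpSeq]
  have : (k : ℝ) + 1 ≠ 0 := by positivity
  field_simp
  exact le_rfl

end Mollification

/-! ### Convex truncations and the energy inequality for mollified differences -/

/-- `β` is a nonnegative convex `C²` function with derivatives `b` and `b'`, which vanishes
on `(-∞, ε]`. -/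
structure IsConvexTruncation (ε : ℝ) (β b b' : ℝ → ℝ) : Prop where
  hasDerivAt : ∀ s, HasDerivAt β (b s) s
  hasDerivAt' : ∀ s, HasDerivAt b (b' s) s
  continuous : Continuous b'
  deriv_nonneg : ∀ s, 0 ≤ b s
  deriv2_nonneg : ∀ s, 0 ≤ b' s
  eq_zero : ∀ s ≤ ε, β s = 0
  deriv_eq_zero : ∀ s ≤ ε, b s = 0
  deriv2_eq_zero : ∀ s ≤ ε, b' s = 0

theorem hasDerivAt_max_zero_pow (k : ℕ) (s : ℝ) :
    HasDerivAt (fun s => (max s 0) ^ (k + 2)) ((k + 2 : ℕ) * (max s 0) ^ (k + 1)) s := by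
  rcases lt_trichotomy s 0 with h | h | h
  · have : (fun s : ℝ => (max s 0) ^ (k + 2)) =ᶠ[𝓝 s] fun _ => 0 := by
      filter_upwards [Iio_mem_nhds h] with t ht
      rw [max_eq_right (le_of_lt ht)]; simp
    rw [max_eq_right h.le]
    simpa using (hasDerivAt_const s (0 : ℝ)).congr_of_eventuallyEq this
  · subst h
    rw [hasDerivAt_iff_isLittleO_nhds_zero]
    have h1 : (fun h : ℝ => (max h 0) ^ (k + 2)) =O[𝓝 0] fun h : ℝ => h ^ (k + 2) := by
      refine Asymptotics.isBigO_of_le _ fun x => ?_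
      rw [norm_pow, norm_pow]
      gcongr
      rw [Real.norm_eq_abs, Real.norm_eq_abs, abs_of_nonneg (le_max_right x 0)]
      exact max_le (le_abs_self x) (abs_nonneg x)
    have h2 := h1.trans_isLittleO (Asymptotics.isLittleO_pow_id (𝕜 := ℝ) (n := k + 2) (by omega))
    simpa using h2
  · have : (fun s : ℝ => (max s 0) ^ (k + 2)) =ᶠ[𝓝 s] fun s => s ^ (k + 2) := by
      filter_upwards [Ioi_mem_nhds h] with t ht
      rw [max_eq_left (le_of_lt ht)]
    rw [max_eq_left h.le]
    exact (hasDerivAt_pow (k + 2) s).congr_of_eventuallyEq this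

/-- The cube is the smallest integer power of the positive part whose second derivative is
continuous. -/
theorem isConvexTruncation_cube (ε : ℝ) :
    IsConvexTruncation ε (fun s => (max (s - ε) 0) ^ 3) (fun s => 3 * (max (s - ε) 0) ^ 2)
      (fun s => 6 * max (s - ε) 0) where
  hasDerivAt s := by
    simpa using (hasDerivAt_max_zero_pow 1 (s - ε)).comp_sub_const s ε
  hasDerivAt' s := by
    have := ((hasDerivAt_max_zero_pow 0 (s - ε)).comp_sub_const s ε).const_mul 3
    exact this.congr_deriv (by push_cast; ring)
  continuous := by fun_prop
  deriv_nonneg s := by positivity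
  deriv2_nonneg s := by positivity
  eq_zero s h := by rw [max_eq_right (by linarith)]; simp
  deriv_eq_zero s h := by rw [max_eq_right (by linarith)]; simp
  deriv2_eq_zero s h := by rw [max_eq_right (by linarith)]; simp

section Energy

variable {E : Type*} [NormedAddCommGroup E] [NormedSpace ℝ E] [FiniteDimensional ℝ E]
  [MeasurableSpace E] [BorelSpace E] {μ : Measure E} [μ.IsAddHaarMeasure]

theorem integral_fderiv_eq_zero {Φ : E → ℝ} (hΦ : ContDiff ℝ 1 Φ) (hc : HasCompactSupport Φ)
    (v : E) : ∫ z, fderiv ℝ Φ z v ∂μ = 0 := by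
  have hi : Integrable (fun z => fderiv ℝ Φ z v) μ := by
    refine Continuous.integrable_of_hasCompactSupport ?_ ?_
    · exact (hΦ.continuous_fderiv (by norm_num)).clm_apply continuous_const
    · exact hc.fderiv_apply (𝕜 := ℝ) v
  have := integral_mul_fderiv_eq_neg_fderiv_mul_of_integrable (μ := μ) (f := fun _ : E => (1 : ℝ))
    (g := Φ) (v := v) (by simp) (by simpa using hi)
    (by simpa using hΦ.continuous.integrable_of_hasCompactSupport hc)
    (fun _ _ => differentiableAt_const _) (fun _ _ => (hΦ.differentiable (by norm_num)) _)
  simpa using this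

/-- Testing with the reflected bump centred at `z` turns a distributional statement in `W` into a
pointwise one for the mollification at `z`, provided that the ball fits into `W`. -/
theorem isTestFunction_bump (ρ : ContDiffBump (0 : E)) {W : Set E} {z : E}
    (hz : closedBall z ρ.rOut ⊆ W) : IsTestFunction W fun y => ρ.normed μ (z - y) := by
  have hsub : Function.support (fun y => ρ.normed μ (z - y)) ⊆ closedBall z ρ.rOut := by
    intro y hy
    have : z - y ∈ Function.support (ρ.normed μ) := hy
    rw [ρ.support_normed_eq, mem_ball_zero_iff, ← dist_eq_norm, dist_comm] at this
    exact this.le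
  refine ⟨ρ.contDiff_normed.comp (contDiff_const.sub contDiff_id), ?_, ?_⟩
  · exact HasCompactSupport.of_support_subset_isCompact (isCompact_closedBall _ _) hsub
  · exact (closure_minimal hsub isClosed_closedBall).trans hz

/-- The distributional inequality `∂_τ D ≤ ∑ ∂_{e i} F_i` in `W`, where the weak derivatives of
`D` in the directions `e i` are `G_i`. -/
structure IsWeakSubflow {ι : Type*} [Fintype ι] (μ : Measure E) (W : Set E) (e : ι → E) (τ : E)
    (D : E → ℝ) (F G : ι → E → ℝ) : Prop where
  grad : ∀ i ψ, IsTestFunction W ψ →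
    ∫ z, D z * fderiv ℝ ψ z (e i) ∂μ = - ∫ z, G i z * ψ z ∂μ
  sub : ∀ ψ, IsTestFunction W ψ → (∀ z, 0 ≤ ψ z) →
    ∑ i, ∫ z, F i z * fderiv ℝ ψ z (e i) ∂μ ≤ ∫ z, D z * fderiv ℝ ψ z τ ∂μ

variable {ι : Type*} [Fintype ι] {W : Set E} {e : ι → E} {τ : E} {D : E → ℝ} {F G : ι → E → ℝ}

theorem fderiv_mollify_eq_integral_bump (ρ : ContDiffBump (0 : E)) {f : E → ℝ}
    (hf : LocallyIntegrable f μ) (z v : E) :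
    fderiv ℝ (mollify μ ρ f) z v =
      - ∫ y, f y * fderiv ℝ (fun y => ρ.normed μ (z - y)) y v ∂μ := by
  rw [fderiv_mollify ρ hf, ← integral_neg]
  refine integral_congr_ae (.of_forall fun y => ?_)
  dsimp only
  rw [fderiv_comp_sub_left ((ρ.contDiff_normed (n := 1)).differentiable (by norm_num))]
  ring

theorem IsWeakSubflow.fderiv_mollify (h : IsWeakSubflow μ W e τ D F G)
    (hD : LocallyIntegrable D μ) (ρ : ContDiffBump (0 : E)) {z : E}
    (hz : closedBall z ρ.rOut ⊆ W) (i : ι) :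
    fderiv ℝ (mollify μ ρ D) z (e i) = mollify μ ρ (G i) z := by
  rw [fderiv_mollify_eq_integral_bump ρ hD, h.grad i _ (isTestFunction_bump ρ hz), neg_neg,
    mollify_apply']
  simp_rw [mul_comm]

theorem IsWeakSubflow.fderiv_mollify_le (h : IsWeakSubflow μ W e τ D F G)
    (hD : LocallyIntegrable D μ) (hF : ∀ i, LocallyIntegrable (F i) μ) (ρ : ContDiffBump (0 : E))
    {z : E} (hz : closedBall z ρ.rOut ⊆ W) :
    fderiv ℝ (mollify μ ρ D) z τ ≤ ∑ i, fderiv ℝ (mollify μ ρ (F i)) z (e i) := by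
  have := h.sub _ (isTestFunction_bump (μ := μ) ρ hz) fun y => ρ.nonneg_normed _
  simp_rw [fderiv_mollify_eq_integral_bump ρ hD, fun i => fderiv_mollify_eq_integral_bump ρ (hF i),
    Finset.sum_neg_distrib]
  linarith

theorem integrable_truncation_mul {θ : ℝ → ℝ} {d χ R : E → ℝ} (hθ : Continuous θ)
    (hd : Continuous d) (hχ : Continuous χ) (hR : Continuous R) {S : Set E} (hS : IsCompact S)
    (h : ∀ z ∉ S, χ z = 0 ∨ θ (d z) = 0) : Integrable (fun z => θ (d z) * χ z * R z) μ := by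
  refine Continuous.integrable_of_hasCompactSupport (by fun_prop) (.intro hS fun z hz => ?_)
  rcases h z hz with h0 | h0 <;> simp [h0]

/-- The pointwise inequality `∂_τ d ≤ ∑ ∂_{e i} F_i` for the mollified functions is multiplied by
`b(d) χ ≥ 0` and integrated by parts on both sides. Since `χ` is constant in the directions `e i`,
its derivative appears only in the `τ` term. Compact support comes from the truncation together with
`χ`: off `S` one of the two vanishes. -/
theorem IsWeakSubflow.integral_mollify_le (h : IsWeakSubflow μ W e τ D F G)
    (hD : LocallyIntegrable D μ) (hF : ∀ i, LocallyIntegrable (F i) μ)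
    (hG : ∀ i, LocallyIntegrable (G i) μ) (ρ : ContDiffBump (0 : E))
    {ε : ℝ} {β b b' : ℝ → ℝ} (hβ : IsConvexTruncation ε β b b')
    {χ : E → ℝ} (hχ : ContDiff ℝ 1 χ) (hχ0 : ∀ z, 0 ≤ χ z) (hχe : ∀ z i, fderiv ℝ χ z (e i) = 0)
    {S : Set E} (hS : IsCompact S) (hSW : ∀ z ∈ S, closedBall z ρ.rOut ⊆ W)
    (hSχ : ∀ z ∉ S, χ z = 0 ∨ mollify μ ρ D z ≤ ε) :
    ∫ z, b' (mollify μ ρ D z) * χ z * ∑ i, mollify μ ρ (F i) z * mollify μ ρ (G i) z ∂μ ≤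
      ∫ z, β (mollify μ ρ D z) * fderiv ℝ χ z τ ∂μ := by
  set d := mollify μ ρ D with hd
  have hdC : ContDiff ℝ 1 d := contDiff_mollify ρ hD
  have hfC : ∀ i, ContDiff ℝ 1 (mollify μ ρ (F i)) := fun i => contDiff_mollify ρ (hF i)
  have hgC : ∀ i, ContDiff ℝ 1 (mollify μ ρ (G i)) := fun i => contDiff_mollify ρ (hG i)
  have hb1 : ContDiff ℝ 1 b := contDiff_one_iff_deriv.2
    ⟨fun s => (hβ.hasDerivAt' s).differentiableAt, by
      rw [show deriv b = b' from funext fun s => (hβ.hasDerivAt' s).deriv]; exact hβ.continuous⟩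
  have hβ1 : ContDiff ℝ 1 β := contDiff_one_iff_deriv.2
    ⟨fun s => (hβ.hasDerivAt s).differentiableAt, by
      rw [show deriv β = b from funext fun s => (hβ.hasDerivAt s).deriv]; exact hb1.continuous⟩
  -- A zero of the nonnegative function `χ` is a minimum, so the derivative of `χ` vanishes there as
  -- well.
  have hχ' : ∀ z, χ z = 0 → fderiv ℝ χ z = 0 := fun z hz =>
    IsLocalMin.fderiv_eq_zero (.of_forall fun y => by rw [hz]; exact hχ0 y)
  have hΦC : ContDiff ℝ 1 fun z => β (d z) * χ z := (hβ1.comp hdC).mul hχ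
  have hXC : ∀ i, ContDiff ℝ 1 fun z => mollify μ ρ (F i) z * (b (d z) * χ z) := fun i =>
    (hfC i).mul ((hb1.comp hdC).mul hχ)
  have hΦc : HasCompactSupport fun z => β (d z) * χ z := .intro hS fun z hz => by
    rcases hSχ z hz with h0 | h0
    · rw [h0, mul_zero]
    · rw [hβ.eq_zero _ h0, zero_mul]
  have hXc : ∀ i, HasCompactSupport fun z => mollify μ ρ (F i) z * (b (d z) * χ z) :=
    fun i => .intro hS fun z hz => by
    rcases hSχ z hz with h0 | h0
    · rw [h0, mul_zero, mul_zero]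
    · rw [hβ.deriv_eq_zero _ h0, zero_mul, mul_zero]
  have hΦd : ∀ z, fderiv ℝ (fun z => β (d z) * χ z) z τ =
      β (d z) * fderiv ℝ χ z τ + b (d z) * χ z * fderiv ℝ d z τ := fun z => by
    have h1 := (hβ.hasDerivAt (d z)).comp_hasFDerivAt z
      (hdC.differentiable (by norm_num) z).hasFDerivAt
    have h2 := h1.mul (hχ.differentiable (by norm_num) z).hasFDerivAt
    rw [show (fun z => β (d z) * χ z) = (β ∘ d) * χ from rfl, h2.fderiv]
    simp
    ring
  have hXd : ∀ i z, fderiv ℝ (fun z => mollify μ ρ (F i) z * (b (d z) * χ z)) z (e i) =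
      b (d z) * χ z * fderiv ℝ (mollify μ ρ (F i)) z (e i) +
        b' (d z) * χ z * (mollify μ ρ (F i) z * fderiv ℝ d z (e i)) := fun i z => by
    have h1 := (hβ.hasDerivAt' (d z)).comp_hasFDerivAt z
      (hdC.differentiable (by norm_num) z).hasFDerivAt
    have h2 := h1.mul (hχ.differentiable (by norm_num) z).hasFDerivAt
    have h3 := ((hfC i).differentiable (by norm_num) z).hasFDerivAt.mul h2
    rw [show (fun z => mollify μ ρ (F i) z * (b (d z) * χ z)) =
      mollify μ ρ (F i) * ((b ∘ d) * χ) from rfl, h3.fderiv]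
    simp [hχe]
    ring
  have hΦ0 := integral_fderiv_eq_zero (μ := μ) hΦC hΦc τ
  have hX0 := fun i => integral_fderiv_eq_zero (μ := μ) (hXC i) (hXc i) (e i)
  have hΦi : Integrable (fun z => fderiv ℝ (fun z => β (d z) * χ z) z τ) μ :=
    ((hΦC.continuous_fderiv (by norm_num)).clm_apply
      continuous_const).integrable_of_hasCompactSupport (hΦc.fderiv_apply (𝕜 := ℝ) τ)
  have hXi : ∀ i, Integrable
      (fun z => fderiv ℝ (fun z => mollify μ ρ (F i) z * (b (d z) * χ z)) z (e i)) μ := fun i =>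
    (((hXC i).continuous_fderiv (by norm_num)).clm_apply
      continuous_const).integrable_of_hasCompactSupport ((hXc i).fderiv_apply (𝕜 := ℝ) (e i))
  have hRi : Integrable (fun z => β (d z) * fderiv ℝ χ z τ) μ := by
    refine Continuous.integrable_of_hasCompactSupport ?_ (.intro hS fun z hz => ?_)
    · exact (hβ1.continuous.comp hdC.continuous).mul
        ((hχ.continuous_fderiv (by norm_num)).clm_apply continuous_const)
    · rcases hSχ z hz with h0 | h0
      · rw [hχ' z h0]; simp
      · rw [hβ.eq_zero _ h0, zero_mul]
  have hLi : Integrable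
      (fun z => b' (d z) * χ z * ∑ i, mollify μ ρ (F i) z * mollify μ ρ (G i) z) μ :=
    integrable_truncation_mul hβ.continuous hdC.continuous hχ.continuous
      (continuous_finsetSum _ fun i _ => (hfC i).continuous.mul (hgC i).continuous) hS
      fun z hz => (hSχ z hz).imp_right (hβ.deriv2_eq_zero _)
  -- The difference of the two divergence terms: both integrate to zero, so integrating this bound
  -- yields the claim.
  have hpt : ∀ z, fderiv ℝ (fun z => β (d z) * χ z) z τ -
      ∑ i, fderiv ℝ (fun z => mollify μ ρ (F i) z * (b (d z) * χ z)) z (e i) ≤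
      β (d z) * fderiv ℝ χ z τ -
        b' (d z) * χ z * ∑ i, mollify μ ρ (F i) z * mollify μ ρ (G i) z := by
    intro z
    simp_rw [hΦd, hXd, Finset.sum_add_distrib, ← Finset.mul_sum]
    by_cases hz : z ∈ S
    · have h1 := h.fderiv_mollify_le hD hF ρ (hSW z hz)
      have h2 := fun i => h.fderiv_mollify hD ρ (hSW z hz) i
      simp_rw [hd, h2]
      have h3 := mul_le_mul_of_nonneg_left h1 (mul_nonneg (hβ.deriv_nonneg (d z)) (hχ0 z))
      rw [hd] at h3
      linarith
    · rcases hSχ z hz with h0 | h0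
      · rw [h0]; simp
      · rw [hβ.deriv_eq_zero _ h0, hβ.deriv2_eq_zero _ h0]; simp
  have hmono := integral_mono (hΦi.sub (integrable_finsetSum _ fun i _ => hXi i))
    (hRi.sub hLi) hpt
  simp only [Pi.sub_apply] at hmono
  rw [integral_sub hΦi (integrable_finsetSum _ fun i _ => hXi i), hΦ0,
    integral_finsetSum _ (fun i _ => hXi i), integral_sub hRi hLi,
    Finset.sum_eq_zero fun i _ => hX0 i] at hmono
  linarith

end Energy

/-! ### Passage to the limit in the energy inequality -/

/-- Hölder's inequality applied to each term of `f_k g_k - f g = (f_k - f)(g_k - g) + (f_k - f) g +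
f (g_k - g)`. -/
theorem tendsto_eLpNorm_mul_sub_mul {α : Type*} [MeasurableSpace α] {μ : Measure α} {p q : ℝ≥0∞}
    [p.HolderConjugate q] {f g : α → ℝ} {fs gs : ℕ → α → ℝ} (hf : MemLp f p μ) (hg : MemLp g q μ)
    (hfs : ∀ k, AEStronglyMeasurable (fs k) μ) (hgs : ∀ k, AEStronglyMeasurable (gs k) μ)
    (hft : Tendsto (fun k => eLpNorm (fun x => fs k x - f x) p μ) atTop (𝓝 0))
    (hgt : Tendsto (fun k => eLpNorm (fun x => gs k x - g x) q μ) atTop (𝓝 0)) :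
    Tendsto (fun k => eLpNorm (fun x => fs k x * gs k x - f x * g x) 1 μ) atTop (𝓝 0) := by
  have hlim : Tendsto (fun k => eLpNorm (fun x => fs k x - f x) p μ *
      eLpNorm (fun x => gs k x - g x) q μ + eLpNorm (fun x => fs k x - f x) p μ * eLpNorm g q μ +
      eLpNorm f p μ * eLpNorm (fun x => gs k x - g x) q μ) atTop (𝓝 0) := by
    have h1 := ENNReal.Tendsto.mul hft (by simp) hgt (by simp)
    have h2 := ENNReal.Tendsto.mul_const hft (Or.inr hg.eLpNorm_ne_top)
    have h3 := ENNReal.Tendsto.const_mul hgt (Or.inr hf.eLpNorm_ne_top)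
    simpa using (h1.add h2).add h3
  refine tendsto_of_tendsto_of_tendsto_of_le_of_le tendsto_const_nhds hlim (fun _ => zero_le)
    fun k => ?_
  have hF : AEStronglyMeasurable (fun x => fs k x - f x) μ := (hfs k).sub hf.1
  have hG : AEStronglyMeasurable (fun x => gs k x - g x) μ := (hgs k).sub hg.1
  calc eLpNorm (fun x => fs k x * gs k x - f x * g x) 1 μ
      = eLpNorm (((fun x => fs k x - f x) • (fun x => gs k x - g x) +
        (fun x => fs k x - f x) • g) + f • (fun x => gs k x - g x)) 1 μ := by
        congr 1; ext x; simp; ring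
    _ ≤ _ := (eLpNorm_add_le ((hF.smul hG).add (hF.smul hg.1)) (hf.1.smul hG) le_rfl).trans
        (add_le_add_left (eLpNorm_add_le (hF.smul hG) (hF.smul hg.1) le_rfl) _)
    _ ≤ _ := add_le_add (add_le_add (eLpNorm_smul_le_mul_eLpNorm hG hF)
        (eLpNorm_smul_le_mul_eLpNorm hg.1 hF)) (eLpNorm_smul_le_mul_eLpNorm hG hf.1)

section Energy

variable {E : Type*} [NormedAddCommGroup E] [NormedSpace ℝ E] [FiniteDimensional ℝ E]
  [MeasurableSpace E] [BorelSpace E] {μ : Measure E} [μ.IsAddHaarMeasure]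

theorem tendsto_integral_abs_mollify_mul_sub {p q : ℝ≥0∞} [p.HolderConjugate q] (hp : p ≠ ∞)
    (hq : q ≠ ∞) {f g : E → ℝ} (hf : MemLp f p μ) (hg : MemLp g q μ) :
    Tendsto (fun k => ∫ x, |mollify μ (bumpSeq k) f x * mollify μ (bumpSeq k) g x - f x * g x| ∂μ)
      atTop (𝓝 0) := by
  have hp1 : 1 ≤ p := ENNReal.HolderConjugate.one_le p q
  have hq1 : 1 ≤ q := ENNReal.HolderConjugate.one_le q p
  have hfs : ∀ k, AEStronglyMeasurable (mollify μ (bumpSeq k) f) μ := fun k =>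
    (contDiff_mollify _ (hf.locallyIntegrable hp1)).continuous.aestronglyMeasurable
  have hgs : ∀ k, AEStronglyMeasurable (mollify μ (bumpSeq k) g) μ := fun k =>
    (contDiff_mollify _ (hg.locallyIntegrable hq1)).continuous.aestronglyMeasurable
  have h := tendsto_eLpNorm_mul_sub_mul hf hg hfs hgs
    (tendsto_eLpNorm_mollify_sub hp1 hp hf) (tendsto_eLpNorm_mollify_sub hq1 hq hg)
  have h' := (ENNReal.tendsto_toReal ENNReal.zero_ne_top).comp h
  rw [ENNReal.toReal_zero] at h'
  refine h'.congr fun k => ?_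
  simp only [Function.comp_apply]
  rw [eLpNorm_one_eq_lintegral_enorm, ← integral_norm_eq_lintegral_enorm]
  · rfl
  · exact ((hfs k).mul (hgs k)).sub (hf.1.mul hg.1)

theorem integrable_abs_mollify_mul_sub {p q : ℝ≥0∞} [p.HolderConjugate q] (hp : p ≠ ∞)
    (hq : q ≠ ∞) {f g : E → ℝ} (hf : MemLp f p μ) (hg : MemLp g q μ) :
    ∀ᶠ k in atTop, Integrable
      (fun x => |mollify μ (bumpSeq k) f x * mollify μ (bumpSeq k) g x - f x * g x|) μ := by
  have hp1 : 1 ≤ p := ENNReal.HolderConjugate.one_le p q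
  have hq1 : 1 ≤ q := ENNReal.HolderConjugate.one_le q p
  have hfs : ∀ k, AEStronglyMeasurable (mollify μ (bumpSeq k) f) μ := fun k =>
    (contDiff_mollify _ (hf.locallyIntegrable hp1)).continuous.aestronglyMeasurable
  have hgs : ∀ k, AEStronglyMeasurable (mollify μ (bumpSeq k) g) μ := fun k =>
    (contDiff_mollify _ (hg.locallyIntegrable hq1)).continuous.aestronglyMeasurable
  have h := tendsto_eLpNorm_mul_sub_mul hf hg hfs hgs
    (tendsto_eLpNorm_mollify_sub hp1 hp hf) (tendsto_eLpNorm_mollify_sub hq1 hq hg)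
  filter_upwards [(tendsto_order.1 h).2 1 one_pos] with k hk
  exact (memLp_one_iff_integrable.1
    ⟨((hfs k).mul (hgs k)).sub (hf.1.mul hg.1), hk.trans ENNReal.one_lt_top⟩).abs

variable {ι : Type*} [Fintype ι] {W : Set E} {e : ι → E} {τ : E} {D : E → ℝ} {F G : ι → E → ℝ}

/-- The elliptic term of the mollified inequality need not converge; a lower bound tending to zero
suffices. Since `∑ F_i G_i ≥ 0`, the mollified sum is at least minus its `L^1`-small error, and its
weight `b'(D_k) χ` is nonnegative and uniformly bounded. The right-hand side converges by dominated
convergence. -/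
theorem IsWeakSubflow.integral_nonneg (h : IsWeakSubflow μ W e τ D F G) {p q : ℝ≥0∞}
    [p.HolderConjugate q] (hp : p ≠ ∞) (hq : q ≠ ∞)
    (hD : Integrable D μ) {M : ℝ} (hM : ∀ z, |D z| ≤ M)
    (hF : ∀ i, MemLp (F i) p μ) (hG : ∀ i, MemLp (G i) q μ)
    (hFG : ∀ z, 0 ≤ ∑ i, F i z * G i z)
    {ε : ℝ} {β b b' : ℝ → ℝ} (hβ : IsConvexTruncation ε β b b')
    {χ : E → ℝ} (hχ : ContDiff ℝ 1 χ) (hχ0 : ∀ z, 0 ≤ χ z) (hχe : ∀ z i, fderiv ℝ χ z (e i) = 0)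
    {K : Set E} (hK : IsCompact K) {r : ℝ} (hr : 0 < r) (hKW : cthickening r K ⊆ W)
    (hKχ : ∀ z, χ z ≠ 0 → ∀ y ∈ ball z r, y ∉ K → D y ≤ ε) :
    0 ≤ ∫ z, β (D z) * fderiv ℝ χ z τ ∂μ := by
  have hp1 : 1 ≤ p := ENNReal.HolderConjugate.one_le p q
  have hq1 : 1 ≤ q := ENNReal.HolderConjugate.one_le q p
  have hDl : LocallyIntegrable D μ := hD.locallyIntegrable
  have hFl : ∀ i, LocallyIntegrable (F i) μ := fun i => (hF i).locallyIntegrable hp1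
  have hGl : ∀ i, LocallyIntegrable (G i) μ := fun i => (hG i).locallyIntegrable hq1
  have hβc : Continuous β := continuous_iff_continuousAt.2 fun s => (hβ.hasDerivAt s).continuousAt
  -- With `rOut < r / 2`, averaging balls centred in `S` stay in the `r`-thickening of `K`, hence in
  -- `W`, while those centred off `S` miss `K`, where `D ≤ ε` if `χ` is nonzero at the centre.
  set S := cthickening (r / 2) K with hSdef
  have hS : IsCompact S := hK.cthickening
  have hχ' : ∀ z, χ z = 0 → fderiv ℝ χ z = 0 := fun z hz =>
    IsLocalMin.fderiv_eq_zero (.of_forall fun y => by rw [hz]; exact hχ0 y)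
  have hχd : Continuous fun z => fderiv ℝ χ z τ :=
    (hχ.continuous_fderiv (by norm_num)).clm_apply continuous_const
  have hsmall : ∀ᶠ k in atTop, (bumpSeq k : ContDiffBump (0 : E)).rOut < r / 2 :=
    (tendsto_order.1 (tendsto_bumpSeq_rOut (E := E))).2 _ (half_pos hr)
  have hSW : ∀ ρ : ContDiffBump (0 : E), ρ.rOut < r / 2 → ∀ z ∈ S, closedBall z ρ.rOut ⊆ W := by
    intro ρ hρ z hz
    refine (closedBall_subset_cthickening hz _).trans ?_
    refine (cthickening_cthickening_subset ρ.rOut_pos.le (half_pos hr).le K).trans ?_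
    exact (cthickening_mono (by linarith) K).trans hKW
  have hSχ : ∀ ρ : ContDiffBump (0 : E), ρ.rOut < r / 2 → ∀ z ∉ S,
      χ z = 0 ∨ mollify μ ρ D z ≤ ε := by
    intro ρ hρ z hz
    refine or_iff_not_imp_left.2 fun hne => mollify_le ρ hD.1 hM z fun y hy => ?_
    refine hKχ z hne y (ball_subset_ball (by linarith) hy) fun hyK => hz ?_
    exact mem_cthickening_of_dist_le z y _ K hyK
      ((mem_ball'.1 hy).le.trans hρ.le)
  obtain ⟨C₁, hC₁⟩ := (isCompact_Icc (a := -M) (b := M)).exists_bound_of_continuousOn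
    hβ.continuous.continuousOn
  obtain ⟨C₂, hC₂0, hC₂⟩ : ∃ C₂ ≥ 0, ∀ z ∈ S, ‖χ z‖ ≤ C₂ := by
    obtain ⟨C, hC⟩ := hS.exists_bound_of_continuousOn hχ.continuous.continuousOn
    exact ⟨max C 0, le_max_right _ _, fun z hz => (hC z hz).trans (le_max_left _ _)⟩
  obtain ⟨C₃, hC₃⟩ := (isCompact_Icc (a := -M) (b := M)).exists_bound_of_continuousOn
    hβc.continuousOn
  obtain ⟨C₄, hC₄⟩ := hS.exists_bound_of_continuousOn hχd.continuousOn
  have hM0 : 0 ≤ M := (abs_nonneg _).trans (hM 0)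
  have hC₁0 : 0 ≤ C₁ := (norm_nonneg _).trans (hC₁ 0 ⟨by linarith, hM0⟩)
  have hC₃0 : 0 ≤ C₃ := (norm_nonneg _).trans (hC₃ 0 ⟨by linarith, hM0⟩)
  have hdm : ∀ (k : ℕ) z, mollify μ (bumpSeq k) D z ∈ Set.Icc (-M) M := fun k z =>
    abs_le.1 (abs_mollify_le _ hM z)
  have hA : Tendsto (fun k => ∫ z, β (mollify μ (bumpSeq k) D z) * fderiv ℝ χ z τ ∂μ) atTop
      (𝓝 (∫ z, β (D z) * fderiv ℝ χ z τ ∂μ)) := by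
    refine tendsto_integral_filter_of_dominated_convergence
      (S.indicator fun _ => C₃ * C₄) (.of_forall fun k => ?_) ?_ ?_ ?_
    · exact ((hβc.comp (contDiff_mollify _ hDl).continuous).mul hχd).aestronglyMeasurable
    · filter_upwards [hsmall] with k hk
      refine .of_forall fun z => ?_
      by_cases hz : z ∈ S
      · rw [Set.indicator_of_mem hz, norm_mul]
        exact mul_le_mul (hC₃ _ (hdm k z)) (hC₄ z hz) (norm_nonneg _) hC₃0
      · rw [Set.indicator_of_notMem hz]
        rcases hSχ _ hk z hz with h0 | h0
        · rw [hχ' z h0]; simp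
        · rw [hβ.eq_zero _ h0]; simp
    · exact (integrable_indicator_iff hS.measurableSet).2
        (integrableOn_const hS.measure_lt_top.ne)
    · filter_upwards [ae_tendsto_mollify hDl] with z hz
      exact ((hβc.tendsto _).comp hz).mul_const _
  have hB : Tendsto (fun k => C₁ * C₂ * ∑ i, ∫ z, |mollify μ (bumpSeq k) (F i) z *
      mollify μ (bumpSeq k) (G i) z - F i z * G i z| ∂μ) atTop (𝓝 0) := by
    simpa using (tendsto_finsetSum Finset.univ fun i _ =>
      tendsto_integral_abs_mollify_mul_sub hp hq (hF i) (hG i)).const_mul (C₁ * C₂)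
  have hAB := hA.add hB
  rw [add_zero] at hAB
  have hint : ∀ᶠ k in atTop, ∀ i, Integrable (fun z => |mollify μ (bumpSeq k) (F i) z *
      mollify μ (bumpSeq k) (G i) z - F i z * G i z|) μ :=
    eventually_all.2 fun i => integrable_abs_mollify_mul_sub hp hq (hF i) (hG i)
  refine ge_of_tendsto hAB ?_
  filter_upwards [hsmall, hint] with k hk hik
  have h1 := h.integral_mollify_le hDl hFl hGl (bumpSeq k) hβ hχ hχ0 hχe hS (hSW _ hk) (hSχ _ hk)
  have hLi := integrable_truncation_mul (μ := μ)
    (R := fun z => ∑ i, mollify μ (bumpSeq k) (F i) z * mollify μ (bumpSeq k) (G i) z) hβ.continuous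
    (contDiff_mollify (bumpSeq k) hDl).continuous hχ.continuous
    (continuous_finsetSum Finset.univ fun i _ =>
      (contDiff_mollify (bumpSeq k) (hFl i)).continuous.mul
        (contDiff_mollify (bumpSeq k) (hGl i)).continuous)
    hS fun z hz => (hSχ _ hk z hz).imp_right (hβ.deriv2_eq_zero _)
  have h2 := integral_mono ((integrable_finsetSum Finset.univ fun i _ => hik i).const_mul
    (C₁ * C₂)).neg hLi fun z => ?_
  · simp only [Pi.neg_apply] at h2
    rw [integral_neg, integral_const_mul, integral_finsetSum _ fun i _ => hik i] at h2
    linarith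
  · simp only [Pi.neg_apply]
    set θ := b' (mollify μ (bumpSeq k) D z) * χ z with hθ
    have hθ0 : 0 ≤ θ := mul_nonneg (hβ.deriv2_nonneg _) (hχ0 z)
    have hsum0 : 0 ≤ ∑ i, |mollify μ (bumpSeq k) (F i) z *
      mollify μ (bumpSeq k) (G i) z - F i z * G i z| := Finset.sum_nonneg fun i _ => abs_nonneg _
    have hle : -(∑ i, |mollify μ (bumpSeq k) (F i) z *
        mollify μ (bumpSeq k) (G i) z - F i z * G i z|) ≤
        ∑ i, mollify μ (bumpSeq k) (F i) z * mollify μ (bumpSeq k) (G i) z := by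
      have : -(∑ i, |mollify μ (bumpSeq k) (F i) z *
        mollify μ (bumpSeq k) (G i) z - F i z * G i z|) ≤
        ∑ i, (mollify μ (bumpSeq k) (F i) z *
        mollify μ (bumpSeq k) (G i) z - F i z * G i z) := by
        rw [← Finset.sum_neg_distrib]
        exact Finset.sum_le_sum fun i _ => neg_abs_le _
      rw [Finset.sum_sub_distrib] at this
      linarith [hFG z]
    by_cases hz : z ∈ S
    · have hθC : θ ≤ C₁ * C₂ :=
        mul_le_mul ((Real.le_norm_self _).trans (hC₁ _ (hdm k z)))
          ((Real.le_norm_self _).trans (hC₂ z hz)) (hχ0 z) hC₁0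
      nlinarith [mul_le_mul_of_nonneg_left hle hθ0, mul_le_mul_of_nonneg_right hθC hsum0]
    · have hθz : θ = 0 := by
        rcases hSχ _ hk z hz with h0 | h0
        · rw [hθ, h0, mul_zero]
        · rw [hθ, hβ.deriv2_eq_zero _ h0, zero_mul]
      rw [hθz, zero_mul, neg_nonpos]
      positivity

end Energy

/-! ### The flux `|v|^{p-2} v`: growth and monotonicity -/

section Flux

variable {n : ℕ} {p : ℝ}

theorem norm_pFlux (hp : 1 < p) (v : EuclideanSpace ℝ (Fin n)) :
    ‖pFlux p v‖ = ‖v‖ ^ (p - 1) := by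
  rw [pFlux, norm_smul, Real.norm_of_nonneg (by positivity)]
  rcases eq_or_ne v 0 with rfl | hv
  · simp [Real.zero_rpow (sub_pos.2 hp).ne']
  · rw [← Real.rpow_add_one (norm_ne_zero_iff.2 hv)]
    congr 1; ring

theorem measurable_pFlux :
    Measurable (pFlux p : EuclideanSpace ℝ (Fin n) → EuclideanSpace ℝ (Fin n)) := by
  unfold pFlux
  exact (measurable_norm.pow_const _).smul measurable_id

theorem norm_mul_rpow (hp : 1 < p) (v : EuclideanSpace ℝ (Fin n)) :
    ‖v‖ ^ (p - 2) * ‖v‖ = ‖v‖ ^ (p - 1) := by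
  rw [← norm_pFlux hp, pFlux, norm_smul, Real.norm_of_nonneg (by positivity)]

/-- Monotonicity of the `p`-Laplacian flux. -/
theorem inner_pFlux_sub_nonneg (hp : 1 < p) (v w : EuclideanSpace ℝ (Fin n)) :
    0 ≤ inner ℝ (pFlux p v - pFlux p w) (v - w) := by
  have h1 : (0 : ℝ) ≤ ‖v‖ ^ (p - 2) := by positivity
  have h2 : (0 : ℝ) ≤ ‖w‖ ^ (p - 2) := by positivity
  -- By Cauchy–Schwarz the inner product is at least `(|v|^{p-1} - |w|^{p-1}) (|v| - |w|)`, a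
  -- product of factors of equal sign because `s ↦ s^{p-1}` is increasing.
  have h3 : 0 ≤ (‖v‖ ^ (p - 1) - ‖w‖ ^ (p - 1)) * (‖v‖ - ‖w‖) := by
    rcases le_total ‖v‖ ‖w‖ with h | h
    · exact mul_nonneg_of_nonpos_of_nonpos (sub_nonpos.2 (Real.rpow_le_rpow (norm_nonneg _) h
        (by linarith))) (sub_nonpos.2 h)
    · exact mul_nonneg (sub_nonneg.2 (Real.rpow_le_rpow (norm_nonneg _) h (by linarith)))
        (sub_nonneg.2 h)
  rw [← norm_mul_rpow hp, ← norm_mul_rpow hp] at h3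
  have h4 := mul_le_mul_of_nonneg_left (real_inner_le_norm v w) (add_nonneg h1 h2)
  simp only [pFlux, inner_sub_left, inner_sub_right, real_inner_smul_left,
    real_inner_self_eq_norm_sq, real_inner_comm v w] at h4 ⊢
  nlinarith

theorem holderConjugate_conjExponent (hp : 1 < p) :
    (ENNReal.ofReal (p / (p - 1))).HolderConjugate (ENNReal.ofReal p) :=
  (Real.HolderConjugate.conjExponent hp).symm.ennrealOfReal

/-- The flux has norm `|G|^{p-1}`, so it lies in the space dual to that of `G`; this makes the
products of fluxes and gradients integrable. -/
theorem MemLpLoc.pFlux {V : Type*} [TopologicalSpace V] [MeasureSpace V] (hp : 1 < p) {O : Set V}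
    {G : V → EuclideanSpace ℝ (Fin n)} (hG : MemLpLoc p O G) :
    MemLpLoc (p / (p - 1)) O fun z => pFlux p (G z) := by
  intro K hKO hK
  have h1 := (hG K hKO hK).norm_rpow_div (ENNReal.ofReal (p - 1))
  rw [ENNReal.toReal_ofReal (by linarith), ← ENNReal.ofReal_div_of_pos (by linarith)] at h1
  refine h1.mono (measurable_pFlux.comp_aemeasurable
    (hG K hKO hK).1.aemeasurable).aestronglyMeasurable (.of_forall fun z => ?_)
  rw [norm_pFlux hp]
  exact Real.le_norm_self _

theorem MemLpLoc.apply {V : Type*} [TopologicalSpace V] [MeasureSpace V] {O : Set V}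
    {G : V → EuclideanSpace ℝ (Fin n)} (hG : MemLpLoc p O G) (i : Fin n) :
    MemLpLoc p O fun z => G z i := by
  intro K hKO hK
  refine (hG K hKO hK).mono ?_ (.of_forall fun z => PiLp.norm_apply_le (G z) i)
  exact ((EuclideanSpace.proj (𝕜 := ℝ) i).continuous.measurable.comp_aemeasurable
    (hG K hKO hK).1.aemeasurable).aestronglyMeasurable

theorem MemLpLoc.sub {V F : Type*} [TopologicalSpace V] [MeasureSpace V] [NormedAddCommGroup F]
    {O : Set V} {v w : V → F} (hv : MemLpLoc p O v) (hw : MemLpLoc p O w) :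
    MemLpLoc p O fun z => v z - w z :=
  fun K hKO hK => (hv K hKO hK).sub (hw K hKO hK)

theorem MemLpLoc.mono {V F : Type*} [TopologicalSpace V] [MeasureSpace V] [NormedAddCommGroup F]
    {O O' : Set V} {v : V → F} (hv : MemLpLoc p O v) (h : O' ⊆ O) : MemLpLoc p O' v :=
  fun K hKO hK => hv K (hKO.trans h) hK

end Flux

/-! ### Test functions -/

section TestFunctions

variable {V : Type*} [NormedAddCommGroup V] [NormedSpace ℝ V] {O O' : Set V} {ψ : V → ℝ}

theorem IsTestFunction.mono (hψ : IsTestFunction O ψ) (h : O ⊆ O') : IsTestFunction O' ψ :=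
  ⟨hψ.smooth, hψ.compact_support, hψ.support_subset.trans h⟩

theorem IsTestFunction.contDiff_one (hψ : IsTestFunction O ψ) : ContDiff ℝ 1 ψ :=
  hψ.smooth.of_le (by exact_mod_cast le_top)

theorem IsTestFunction.differentiable (hψ : IsTestFunction O ψ) : Differentiable ℝ ψ :=
  hψ.contDiff_one.differentiable (by norm_num)

theorem IsTestFunction.continuous_fderiv_apply (hψ : IsTestFunction O ψ) (e : V) :
    Continuous fun z => fderiv ℝ ψ z e :=
  (hψ.contDiff_one.continuous_fderiv (by norm_num)).clm_apply continuous_const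

theorem IsTestFunction.fderiv_eq_zero (hψ : IsTestFunction O ψ) {z : V} (hz : z ∉ O) :
    fderiv ℝ ψ z = 0 :=
  fderiv_of_notMem_tsupport ℝ fun h => hz (hψ.support_subset h)

theorem IsTestFunction.eq_zero (hψ : IsTestFunction O ψ) {z : V} (hz : z ∉ O) : ψ z = 0 :=
  image_eq_zero_of_notMem_tsupport fun h => hz (hψ.support_subset h)

theorem IsTestFunction.tsupport_fderiv_apply_subset (hψ : IsTestFunction O ψ) (e : V) :
    tsupport (fun z => fderiv ℝ ψ z e) ⊆ O :=
  (_root_.tsupport_fderiv_apply_subset ℝ e).trans hψ.support_subset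

end TestFunctions

/-- The product of an `L^p_loc` function with a continuous function with compact support in `O`
is integrable. -/
theorem MemLpLoc.integrable_mul {V : Type*} [TopologicalSpace V] [R1Space V] [MeasureSpace V]
    [OpensMeasurableSpace V] [IsFiniteMeasureOnCompacts (volume : Measure V)] {p : ℝ} (hp : 1 ≤ p)
    {O : Set V} {w h : V → ℝ} (hw : MemLpLoc p O w) (hh : Continuous h) (hc : HasCompactSupport h)
    (hO : tsupport h ⊆ O) : Integrable (fun z => w z * h z) := by
  have hfin : IsFiniteMeasure (volume.restrict (tsupport h)) :=
    ⟨by rw [Measure.restrict_apply_univ]; exact hc.isCompact.measure_lt_top⟩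
  have h1 : IntegrableOn w (tsupport h) :=
    (hw _ hO hc.isCompact).integrable (by simpa using ENNReal.ofReal_le_ofReal hp)
  obtain ⟨C, hC⟩ := hc.exists_bound_of_continuous hh
  have h2 : IntegrableOn (fun z => w z * h z) (tsupport h) :=
    Integrable.mul_bdd h1 hh.aestronglyMeasurable (.of_forall hC)
  rw [integrableOn_iff_integrable_of_support_subset] at h2
  · exact h2
  · exact (Function.support_mul_subset_right _ _).trans subset_closure

/-! ### The weak form on the whole space and in coordinates -/

section WeakForm

variable {n : ℕ} {p : ℝ} {O O' : Set (EuclideanSpace ℝ (Fin n) × ℝ)}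
  {w v : EuclideanSpace ℝ (Fin n) × ℝ → ℝ}
  {G : EuclideanSpace ℝ (Fin n) × ℝ → EuclideanSpace ℝ (Fin n)}
  {ψ : EuclideanSpace ℝ (Fin n) × ℝ → ℝ}

instance : (volume : Measure (EuclideanSpace ℝ (Fin n) × ℝ)).IsAddHaarMeasure :=
  inferInstanceAs ((volume : Measure (EuclideanSpace ℝ (Fin n))).prod
    (volume : Measure ℝ)).IsAddHaarMeasure

/-- `Δ_p w - w_t ≥ 0` weakly in the open set `O`. -/
def IsWeakSubsolution (p : ℝ) (O : Set (EuclideanSpace ℝ (Fin n) × ℝ))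
    (w : EuclideanSpace ℝ (Fin n) × ℝ → ℝ) : Prop :=
  ∃ G, HasWeakSpatialGrad p O w G ∧
    ∀ ψ, IsTestFunction O ψ → (∀ z, 0 ≤ ψ z) → weakForm p O w G ψ ≤ 0

theorem IsWeakSolution.isWeakSubsolution (h : IsWeakSolution p O w) : IsWeakSubsolution p O w :=
  let ⟨G, hG, hw⟩ := h
  ⟨G, hG, fun ψ hψ _ => (hw ψ hψ).le⟩

/-- The spatial unit vector `e_i`, as a vector in space-time. -/
def spaceDir (i : Fin n) : EuclideanSpace ℝ (Fin n) × ℝ := (EuclideanSpace.single i 1, 0)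

theorem apply_space_eq_sum (L : EuclideanSpace ℝ (Fin n) × ℝ →L[ℝ] ℝ)
    (a : EuclideanSpace ℝ (Fin n)) : L (a, 0) = ∑ i, a i * L (spaceDir i) := by
  have : a = ∑ i, a i • EuclideanSpace.single i (1 : ℝ) := by
    simpa using ((EuclideanSpace.basisFun (Fin n) ℝ).sum_repr a).symm
  calc L (a, 0) = (L.comp (ContinuousLinearMap.inl ℝ _ ℝ)) a := rfl
    _ = (L.comp (ContinuousLinearMap.inl ℝ _ ℝ)) (∑ i, a i • EuclideanSpace.single i (1 : ℝ)) := by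
        rw [← this]
    _ = _ := by rw [map_sum]; simp [spaceDir]

/-- Test functions vanish off `O`, so integrals over `O` are integrals over the whole space. In that
form the weak formulations restrict to smaller sets and translate without further work. -/
theorem setIntegral_mul_fderiv (hψ : IsTestFunction O ψ) (e : EuclideanSpace ℝ (Fin n) × ℝ) :
    ∫ z in O, w z * fderiv ℝ ψ z e = ∫ z, w z * fderiv ℝ ψ z e :=
  setIntegral_eq_integral_of_forall_compl_eq_zero fun z hz => by
    rw [hψ.fderiv_eq_zero hz]; simp

theorem HasWeakSpatialGrad.integral_eq' (h : HasWeakSpatialGrad p O w G)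
    (hψ : IsTestFunction O ψ) (e : EuclideanSpace ℝ (Fin n)) :
    ∫ z, w z * fderiv ℝ ψ z (e, 0) = - ∫ z, inner ℝ (G z) e * ψ z := by
  rw [← setIntegral_mul_fderiv hψ, h.integral_eq ψ hψ e,
    setIntegral_eq_integral_of_forall_compl_eq_zero fun z hz => by rw [hψ.eq_zero hz, mul_zero]]

theorem weakForm_eq_integral (hψ : IsTestFunction O ψ) :
    weakForm p O w G ψ =
      ∫ z, (fderiv ℝ ψ z (pFlux p (G z), 0) - w z * fderiv ℝ ψ z (0, 1)) :=
  setIntegral_eq_integral_of_forall_compl_eq_zero fun z hz => by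
    rw [hψ.fderiv_eq_zero hz]; simp

theorem MemLpLoc.integrable_mul_fderiv (hp : 1 ≤ p) (hw : MemLpLoc p O w)
    (hψ : IsTestFunction O ψ) (e : EuclideanSpace ℝ (Fin n) × ℝ) :
    Integrable fun z => w z * fderiv ℝ ψ z e :=
  hw.integrable_mul hp (hψ.continuous_fderiv_apply e)
    (hψ.compact_support.fderiv_apply (𝕜 := ℝ) e) (hψ.tsupport_fderiv_apply_subset e)

theorem one_le_conjExponent (hp : 1 < p) : 1 ≤ p / (p - 1) :=
  (Real.HolderConjugate.conjExponent hp).symm.lt.le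

theorem HasWeakSpatialGrad.integrable_pFlux_mul (hp : 1 < p) (h : HasWeakSpatialGrad p O w G)
    (hψ : IsTestFunction O ψ) (i : Fin n) (e : EuclideanSpace ℝ (Fin n) × ℝ) :
    Integrable fun z => pFlux p (G z) i * fderiv ℝ ψ z e :=
  ((h.grad_memLp.pFlux hp).apply i).integrable_mul_fderiv (one_le_conjExponent hp) hψ e

theorem HasWeakSpatialGrad.integrable_fderiv_pFlux (hp : 1 < p) (h : HasWeakSpatialGrad p O w G)
    (hψ : IsTestFunction O ψ) : Integrable fun z => fderiv ℝ ψ z (pFlux p (G z), 0) := by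
  simp_rw [apply_space_eq_sum]
  exact integrable_finsetSum _ fun i _ => h.integrable_pFlux_mul hp hψ i _

theorem HasWeakSpatialGrad.weakForm_eq (hp : 1 < p) (h : HasWeakSpatialGrad p O w G)
    (hψ : IsTestFunction O ψ) :
    weakForm p O w G ψ = (∑ i, ∫ z, pFlux p (G z) i * fderiv ℝ ψ z (spaceDir i)) -
      ∫ z, w z * fderiv ℝ ψ z (0, 1) := by
  rw [weakForm_eq_integral hψ, integral_sub (h.integrable_fderiv_pFlux hp hψ)
    (h.memLp.integrable_mul_fderiv hp.le hψ _)]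
  simp_rw [apply_space_eq_sum]
  rw [integral_finsetSum _ fun i _ => h.integrable_pFlux_mul hp hψ i _]

end WeakForm

/-! ### The comparison principle -/

section Comparison

variable {n : ℕ} {p : ℝ} {O : Set (EuclideanSpace ℝ (Fin n) × ℝ)}
  {w v : EuclideanSpace ℝ (Fin n) × ℝ → ℝ}

/-- Subtract the two weak inequalities. Cutting off with `K` makes the data globally integrable when
`K` is compact, and test functions supported in the interior of `K` do not see the cut. -/
theorem isWeakSubflow_indicator_sub (hp : 1 < p)
    {Gw Gv : EuclideanSpace ℝ (Fin n) × ℝ → EuclideanSpace ℝ (Fin n)}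
    (hGw : HasWeakSpatialGrad p O w Gw) (hGv : HasWeakSpatialGrad p O v Gv)
    (hw : ∀ ψ, IsTestFunction O ψ → (∀ z, 0 ≤ ψ z) → weakForm p O w Gw ψ ≤ 0)
    (hv : ∀ ψ, IsTestFunction O ψ → (∀ z, 0 ≤ ψ z) → 0 ≤ weakForm p O v Gv ψ)
    {K : Set (EuclideanSpace ℝ (Fin n) × ℝ)} (hKO : K ⊆ O) :
    IsWeakSubflow volume (interior K) spaceDir (0, 1) (K.indicator fun z => w z - v z)
      (fun i => K.indicator fun z => (pFlux p (Gw z) - pFlux p (Gv z)) i)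
      (fun i => K.indicator fun z => (Gw z - Gv z) i) := by
  have hind : ∀ {ψ : EuclideanSpace ℝ (Fin n) × ℝ → ℝ}, IsTestFunction (interior K) ψ →
      ∀ (f g : EuclideanSpace ℝ (Fin n) × ℝ → ℝ) (z e : EuclideanSpace ℝ (Fin n) × ℝ),
      K.indicator (fun z => f z - g z) z * fderiv ℝ ψ z e =
        f z * fderiv ℝ ψ z e - g z * fderiv ℝ ψ z e := by
    intro ψ hψ f g z e
    by_cases hz : z ∈ K
    · rw [Set.indicator_of_mem hz]; ring
    · rw [Set.indicator_of_notMem hz, (hψ.mono interior_subset).fderiv_eq_zero hz]; simp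
  have hsub : interior K ⊆ O := interior_subset.trans hKO
  constructor
  · intro i ψ hψ
    have hψO := hψ.mono hsub
    have hG : ∀ {G : EuclideanSpace ℝ (Fin n) × ℝ → EuclideanSpace ℝ (Fin n)},
        MemLpLoc p O G → Integrable fun z => G z i * ψ z := fun hG =>
      (hG.apply i).integrable_mul hp.le hψ.smooth.continuous hψ.compact_support hψO.support_subset
    have e1 := hGw.integral_eq' hψO (EuclideanSpace.single i 1)
    have e2 := hGv.integral_eq' hψO (EuclideanSpace.single i 1)
    simp only [EuclideanSpace.inner_single_right, one_mul, conj_trivial] at e1 e2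
    simp_rw [hind hψ]
    rw [integral_sub (hGw.memLp.integrable_mul_fderiv hp.le hψO _)
      (hGv.memLp.integrable_mul_fderiv hp.le hψO _)]
    unfold spaceDir
    rw [e1, e2, neg_sub_neg, ← neg_sub, ← integral_sub (hG hGw.grad_memLp) (hG hGv.grad_memLp)]
    congr 1
    refine integral_congr_ae (.of_forall fun z => ?_)
    dsimp only
    by_cases hz : z ∈ K
    · rw [Set.indicator_of_mem hz, PiLp.sub_apply]; ring
    · rw [(hψ.mono interior_subset).eq_zero hz]; simp
  · intro ψ hψ hψ0
    have hψO := hψ.mono hsub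
    have e1 := hw ψ hψO hψ0
    have e2 := hv ψ hψO hψ0
    rw [hGw.weakForm_eq hp hψO] at e1
    rw [hGv.weakForm_eq hp hψO] at e2
    simp only [PiLp.sub_apply]
    simp_rw [hind hψ]
    rw [integral_sub (hGw.memLp.integrable_mul_fderiv hp.le hψO _)
      (hGv.memLp.integrable_mul_fderiv hp.le hψO _)]
    simp_rw [fun i => integral_sub (hGw.integrable_pFlux_mul hp hψO i (spaceDir i))
      (hGv.integrable_pFlux_mul hp hψO i (spaceDir i)), Finset.sum_sub_distrib]
    linarith

theorem hasFDerivAt_timeCutoff (T : ℝ) (z : EuclideanSpace ℝ (Fin n) × ℝ) :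
    HasFDerivAt (fun z : EuclideanSpace ℝ (Fin n) × ℝ => (max (T - z.2) 0) ^ 2)
      ((-(2 * max (T - z.2) 0)) • ContinuousLinearMap.snd ℝ (EuclideanSpace ℝ (Fin n)) ℝ) z := by
  have h1 : HasFDerivAt (fun z : EuclideanSpace ℝ (Fin n) × ℝ => T - z.2)
      (-ContinuousLinearMap.snd ℝ (EuclideanSpace ℝ (Fin n)) ℝ) z :=
    hasFDerivAt_snd.const_sub T
  have h2 := (hasDerivAt_max_zero_pow 0 (T - z.2)).comp_hasFDerivAt z h1
  refine h2.congr_fderiv ?_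
  ext <;> simp

theorem contDiff_timeCutoff (T : ℝ) :
    ContDiff ℝ 1 fun z : EuclideanSpace ℝ (Fin n) × ℝ => (max (T - z.2) 0) ^ 2 := by
  rw [contDiff_one_iff_fderiv]
  refine ⟨fun z => (hasFDerivAt_timeCutoff T z).differentiableAt, ?_⟩
  rw [show fderiv ℝ (fun z : EuclideanSpace ℝ (Fin n) × ℝ => (max (T - z.2) 0) ^ 2) = _ from
    funext fun z => (hasFDerivAt_timeCutoff T z).fderiv]
  fun_prop

/-- Local form of the comparison principle: if `w - v < ε` on `O` outside of a compact set, up to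
some time, then `w - v ≤ ε`. -/
theorem sub_le_of_isWeakSubsolution (hp : 1 < p) (hO : IsOpen O) (hwc : ContinuousOn w O)
    (hvc : ContinuousOn v O) (hw : IsWeakSubsolution p O w) (hv : IsWeakSupersolution p O v)
    {K : Set (EuclideanSpace ℝ (Fin n) × ℝ)} (hK : IsCompact K) (hKO : K ⊆ O) {ε T₁ T₂ : ℝ}
    (hε : 0 ≤ ε) (hT : T₂ < T₁) (hKε : ∀ z ∈ O, z.2 < T₁ → ε < w z - v z → z ∈ K) :
    ∀ z ∈ O, z.2 < T₂ → w z - v z ≤ ε := by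
  obtain ⟨Gw, hGw, hw⟩ := hw
  obtain ⟨Gv, hGv, hv⟩ := hv
  obtain ⟨δ, hδ, hδO⟩ := hK.exists_cthickening_subset_open hO hKO
  set K' := cthickening δ K with hK'def
  have hK' : IsCompact K' := hK.cthickening
  have hKK' : K ⊆ K' := self_subset_cthickening K
  -- The bound `δ / 2` keeps the `r`-thickening of `K` in the interior of `K'`. The bound `T₁ - T₂`
  -- ensures that points within `r` of a time before `T₂` lie before `T₁`, where `hKε` applies.
  set r := min (δ / 2) (T₁ - T₂) with hrdef
  have hr : 0 < r := lt_min (half_pos hδ) (sub_pos.2 hT)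
  have hKW : cthickening r K ⊆ interior K' := by
    refine (cthickening_subset_thickening' hδ ((min_le_left _ _).trans_lt (half_lt_self hδ))
      K).trans ?_
    exact interior_maximal (thickening_subset_cthickening δ K) isOpen_thickening
  have hflow := isWeakSubflow_indicator_sub hp hGw hGv hw hv hδO
  set D := K'.indicator fun z => w z - v z with hD
  have hDc : ContinuousOn (fun z => w z - v z) K' := (hwc.sub hvc).mono hδO
  obtain ⟨M, hM0, hM⟩ : ∃ M ≥ 0, ∀ z, |D z| ≤ M := by
    obtain ⟨C, hC⟩ := hK'.exists_bound_of_continuousOn hDc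
    refine ⟨max C 0, le_max_right _ _, fun z => ?_⟩
    by_cases hz : z ∈ K'
    · rw [hD, Set.indicator_of_mem hz]; exact (hC z hz).trans (le_max_left _ _)
    · rw [hD, Set.indicator_of_notMem hz, abs_zero]; exact le_max_right _ _
  have hDi : Integrable D :=
    (integrable_indicator_iff hK'.measurableSet).2 (hDc.integrableOn_compact hK')
  have hconj := holderConjugate_conjExponent hp
  have hβ := isConvexTruncation_cube ε
  have hτ : ∀ z : EuclideanSpace ℝ (Fin n) × ℝ,
      fderiv ℝ (fun z : EuclideanSpace ℝ (Fin n) × ℝ => (max (T₂ - z.2) 0) ^ 2) z (0, 1) =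
        -(2 * max (T₂ - z.2) 0) := fun z => by
    rw [(hasFDerivAt_timeCutoff T₂ z).fderiv]; simp
  have hle : ∀ z, z.2 < T₁ → z ∉ K → D z ≤ ε := by
    intro z hz hzK
    by_cases hz' : z ∈ K'
    · rw [hD, Set.indicator_of_mem hz']
      exact not_lt.1 fun hlt => hzK (hKε z (hδO hz') hz hlt)
    · rwa [hD, Set.indicator_of_notMem hz']
  have hnn := hflow.integral_nonneg ENNReal.ofReal_ne_top ENNReal.ofReal_ne_top hDi hM
    (fun i => (memLp_indicator_iff_restrict hK'.measurableSet).2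
      (((hGw.grad_memLp.pFlux hp).sub (hGv.grad_memLp.pFlux hp)).apply i K' hδO hK'))
    (fun i => (memLp_indicator_iff_restrict hK'.measurableSet).2
      ((hGw.grad_memLp.sub hGv.grad_memLp).apply i K' hδO hK'))
    (fun z => by
      by_cases hz : z ∈ K'
      · simp_rw [Set.indicator_of_mem hz]
        refine (inner_pFlux_sub_nonneg hp (Gw z) (Gv z)).trans_eq ?_
        rw [PiLp.inner_apply]
        exact Finset.sum_congr rfl fun i _ => by simp [mul_comm]
      · simp [Set.indicator_of_notMem hz])
    hβ (contDiff_timeCutoff T₂) (fun z => by positivity)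
    (fun z i => by rw [(hasFDerivAt_timeCutoff T₂ z).fderiv]; simp [spaceDir])
    hK hr hKW (fun z hz y hy hyK => by
      refine hle y ?_ hyK
      have h1 : z.2 < T₂ := by
        by_contra hge
        exact hz (by rw [max_eq_right (by linarith)]; simp)
      have h2 : |y.2 - z.2| < r := by
        have h3 : dist y z < r := hy
        rw [Prod.dist_eq] at h3
        exact (le_max_right _ _).trans_lt h3
      have := (abs_lt.1 h2).2
      have : r ≤ T₁ - T₂ := min_le_right _ _
      linarith)
  simp_rw [hτ] at hnn
  set f := fun z : EuclideanSpace ℝ (Fin n) × ℝ =>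
    (max (D z - ε) 0) ^ 3 * (2 * max (T₂ - z.2) 0) with hf
  have hf0 : ∀ z, 0 ≤ f z := fun z => by positivity
  have hfK : ∀ z ∉ K, f z = 0 := by
    intro z hz
    rcases lt_or_ge z.2 T₂ with h1 | h1
    · have := hle z (h1.trans hT) hz
      simp only [hf]
      rw [max_eq_right (by linarith : D z - ε ≤ 0)]; simp
    · simp only [hf]
      rw [max_eq_right (by linarith : T₂ - z.2 ≤ 0)]; simp
  obtain ⟨C, hC⟩ := hK.exists_bound_of_continuousOn (f := fun z => max (T₂ - z.2) 0)
    (by fun_prop)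
  have hfi : Integrable f := by
    refine Integrable.mono' (g := K.indicator fun _ => M ^ 3 * (2 * C))
      ((integrable_indicator_iff hK.measurableSet).2 (integrableOn_const hK.measure_lt_top.ne))
      ?_ (.of_forall fun z => ?_)
    · have h1 : Continuous fun s : ℝ => (max (s - ε) 0) ^ 3 := by fun_prop
      have h2 : Continuous fun z : EuclideanSpace ℝ (Fin n) × ℝ => 2 * max (T₂ - z.2) 0 := by
        fun_prop
      exact (h1.comp_aestronglyMeasurable hDi.1).mul h2.aestronglyMeasurable
    · by_cases hz : z ∈ K
      · rw [Set.indicator_of_mem hz, Real.norm_of_nonneg (hf0 z)]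
        have h1 : max (D z - ε) 0 ≤ M :=
          max_le (by linarith [(abs_le.1 (hM z)).2]) hM0
        have h2 := (Real.le_norm_self _).trans (hC z hz)
        simp only [hf]
        gcongr
      · rw [Set.indicator_of_notMem hz, hfK z hz, norm_zero]
  -- The cutoff `((T₂ - t)₊)²` has time derivative `-2 (T₂ - t)₊`, so the energy inequality reads `∫
  -- f ≤ 0`, while `f ≥ 0`.
  have hint : ∫ z, f z = 0 := by
    refine le_antisymm ?_ (integral_nonneg hf0)
    have : ∫ z, (max (D z - ε) 0) ^ 3 * -(2 * max (T₂ - z.2) 0) = - ∫ z, f z := by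
      rw [← integral_neg]
      exact integral_congr_ae (.of_forall fun z => by simp [hf])
    linarith
  have hae := (integral_eq_zero_iff_of_nonneg hf0 hfi).1 hint
  intro z hz hzT
  by_contra! hlt
  -- Vanishing almost everywhere becomes vanishing everywhere by continuity: a violation would occur
  -- on a nonempty open set, which has positive measure.
  set U := O ∩ (fun z => w z - v z) ⁻¹' Set.Ioi ε ∩ Prod.snd ⁻¹' Set.Iio T₂ with hU
  have hUo : IsOpen U :=
    ((hwc.sub hvc).isOpen_inter_preimage hO isOpen_Ioi).inter (isOpen_Iio.preimage continuous_snd)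
  have hUpos : 0 < volume U := hUo.measure_pos _ ⟨z, ⟨hz, hlt⟩, hzT⟩
  refine hUpos.ne' (measure_mono_null (fun y hy => ?_) hae)
  obtain ⟨⟨hyO, hyε⟩, hyT⟩ := hy
  have hyε' : ε < w y - v y := hyε
  have hyT' : y.2 < T₂ := hyT
  have hyK : y ∈ K' := hKK' (hKε y hyO (hyT'.trans hT) hyε')
  have hDy : D y = w y - v y := Set.indicator_of_mem hyK _
  refine ne_of_gt (mul_pos (pow_pos (lt_max_of_lt_left ?_) 3)
    (mul_pos two_pos (lt_max_of_lt_left ?_))) <;> linarith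

/-- Comparison principle: a weak supersolution lies above a weak subsolution (on the set where it
is strictly smaller) if it does so on the parabolic boundary. -/
theorem comparison (hp : 1 < p) {T : ℝ}
    (hwc : ContinuousOn w (closedBall 0 1 ×ˢ Set.Ico 0 T))
    (hvc : ContinuousOn v (closedBall 0 1 ×ˢ Set.Ico 0 T))
    (hinit : ∀ x ∈ closedBall (0 : EuclideanSpace ℝ (Fin n)) 1, w (x, 0) ≤ v (x, 0))
    (hlat : ∀ x ∈ sphere (0 : EuclideanSpace ℝ (Fin n)) 1, ∀ t ∈ Set.Ioo 0 T,
      w (x, t) ≤ v (x, t))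
    (hw : IsWeakSubsolution p {z ∈ ball 0 1 ×ˢ Set.Ioo 0 T | v z < w z} w)
    (hv : IsWeakSupersolution p {z ∈ ball 0 1 ×ˢ Set.Ioo 0 T | v z < w z} v) :
    ∀ z ∈ closedBall (0 : EuclideanSpace ℝ (Fin n)) 1 ×ˢ Set.Ico 0 T, w z ≤ v z := by
  -- The order on the parabolic boundary pushes every point of violation into the open cylinder.
  have hbdry : ∀ z ∈ closedBall (0 : EuclideanSpace ℝ (Fin n)) 1 ×ˢ Set.Ico 0 T, v z < w z →
      z ∈ {z ∈ ball (0 : EuclideanSpace ℝ (Fin n)) 1 ×ˢ Set.Ioo 0 T | v z < w z} := by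
    rintro ⟨x, t⟩ ⟨hx, ht⟩ hlt
    have ht0 : 0 < t := lt_of_le_of_ne ht.1 fun h => by
      subst h
      exact (hinit x hx).not_gt hlt
    refine ⟨⟨?_, ht0, ht.2⟩, hlt⟩
    rw [mem_ball]
    exact lt_of_le_of_ne hx fun h => (hlat x h t ⟨ht0, ht.2⟩).not_gt hlt
  intro z hz
  by_contra! hlt
  -- Nothing is known at time `T`. Stopping at `T₁ < T` makes the set `{w - v ≥ ε}` compact, and `T₂
  -- < T₁` leaves room for the mollification.
  obtain ⟨T₁, hzT₁, hT₁⟩ := exists_between hz.2.2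
  obtain ⟨T₂, hzT₂, hT₂⟩ := exists_between hzT₁
  set ε := (w z - v z) / 2 with hε
  have hε0 : 0 < ε := by rw [hε]; linarith
  have hsubO : {z ∈ ball (0 : EuclideanSpace ℝ (Fin n)) 1 ×ˢ Set.Ioo 0 T | v z < w z} ⊆
      closedBall 0 1 ×ˢ Set.Ico 0 T := fun y hy =>
    ⟨ball_subset_closedBall hy.1.1, Set.Ioo_subset_Ico_self hy.1.2⟩
  have hO : IsOpen {z ∈ ball (0 : EuclideanSpace ℝ (Fin n)) 1 ×ˢ Set.Ioo 0 T | v z < w z} := by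
    have hb : IsOpen (ball (0 : EuclideanSpace ℝ (Fin n)) 1 ×ˢ Set.Ioo 0 T) :=
      isOpen_ball.prod isOpen_Ioo
    have := ((hwc.sub hvc).mono (Set.prod_mono ball_subset_closedBall
      Set.Ioo_subset_Ico_self)).isOpen_inter_preimage hb (isOpen_Ioi (a := (0 : ℝ)))
    refine (congrArg IsOpen (Set.ext fun y => ?_)).mp this
    simp [sub_pos]
  have hKc : IsCompact ((closedBall (0 : EuclideanSpace ℝ (Fin n)) 1 ×ˢ Set.Icc 0 T₁) ∩
      (fun z => w z - v z) ⁻¹' Set.Ici ε) := by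
    have hc : IsCompact (closedBall (0 : EuclideanSpace ℝ (Fin n)) 1 ×ˢ Set.Icc 0 T₁) :=
      (isCompact_closedBall _ _).prod isCompact_Icc
    refine hc.of_isClosed_subset ?_ Set.inter_subset_left
    exact ((hwc.sub hvc).mono (Set.prod_mono le_rfl
      fun t ht => ⟨ht.1, ht.2.trans_lt hT₁⟩)).preimage_isClosed_of_isClosed hc.isClosed isClosed_Ici
  have hmain := sub_le_of_isWeakSubsolution hp hO (hwc.mono hsubO) (hvc.mono hsubO) hw hv hKc
    (fun y hy => hbdry y ⟨hy.1.1, hy.1.2.1, hy.1.2.2.trans_lt hT₁⟩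
      (sub_pos.1 (hε0.trans_le hy.2))) hε0.le hT₂
    (fun y hy hyT hyε => ⟨⟨(hsubO hy).1, (hsubO hy).2.1, hyT.le⟩, hyε.le⟩)
    z (hbdry z hz hlt) hzT₂
  linarith

end Comparison

/-! ### Restriction, addition of constants and translation -/

section Transformations

variable {n : ℕ} {p : ℝ} {O O' : Set (EuclideanSpace ℝ (Fin n) × ℝ)}
  {w v : EuclideanSpace ℝ (Fin n) × ℝ → ℝ}
  {G : EuclideanSpace ℝ (Fin n) × ℝ → EuclideanSpace ℝ (Fin n)}
  {ψ : EuclideanSpace ℝ (Fin n) × ℝ → ℝ}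

theorem hasWeakSpatialGrad_iff : HasWeakSpatialGrad p O w G ↔ MemLpLoc p O w ∧ MemLpLoc p O G ∧
    ∀ ψ, IsTestFunction O ψ → ∀ e : EuclideanSpace ℝ (Fin n),
      ∫ z, w z * fderiv ℝ ψ z (e, 0) = - ∫ z, inner ℝ (G z) e * ψ z := by
  refine ⟨fun h => ⟨h.memLp, h.grad_memLp, fun ψ hψ e => h.integral_eq' hψ e⟩,
    fun ⟨h1, h2, h3⟩ => ⟨h1, h2, fun ψ hψ e => ?_⟩⟩
  rw [setIntegral_mul_fderiv hψ, h3 ψ hψ e,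
    setIntegral_eq_integral_of_forall_compl_eq_zero fun z hz => by rw [hψ.eq_zero hz, mul_zero]]

theorem HasWeakSpatialGrad.mono (h : HasWeakSpatialGrad p O w G) (hO : O' ⊆ O) :
    HasWeakSpatialGrad p O' w G :=
  hasWeakSpatialGrad_iff.2 ⟨h.memLp.mono hO, h.grad_memLp.mono hO,
    fun _ hψ e => h.integral_eq' (hψ.mono hO) e⟩

theorem weakForm_mono (hψ : IsTestFunction O' ψ) (hO : O' ⊆ O) :
    weakForm p O' w G ψ = weakForm p O w G ψ := by
  rw [weakForm_eq_integral hψ, weakForm_eq_integral (hψ.mono hO)]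

theorem IsWeakSubsolution.mono (h : IsWeakSubsolution p O w) (hO : O' ⊆ O) :
    IsWeakSubsolution p O' w :=
  let ⟨G, hG, hw⟩ := h
  ⟨G, hG.mono hO, fun ψ hψ h0 => (weakForm_mono hψ hO).trans_le (hw ψ (hψ.mono hO) h0)⟩

theorem IsWeakSupersolution.mono (h : IsWeakSupersolution p O w) (hO : O' ⊆ O) :
    IsWeakSupersolution p O' w :=
  let ⟨G, hG, hw⟩ := h
  ⟨G, hG.mono hO, fun ψ hψ h0 => (hw ψ (hψ.mono hO) h0).trans_eq (weakForm_mono hψ hO).symm⟩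

theorem MemLpLoc.add_const (h : MemLpLoc p O w) (c : ℝ) : MemLpLoc p O fun z => w z + c := by
  intro K hKO hK
  have : IsFiniteMeasure (volume.restrict K) :=
    ⟨by rw [Measure.restrict_apply_univ]; exact hK.measure_lt_top⟩
  exact (h K hKO hK).add (memLp_const c)

theorem IsTestFunction.integral_fderiv_apply (hψ : IsTestFunction O ψ)
    (e : EuclideanSpace ℝ (Fin n) × ℝ) : ∫ z, fderiv ℝ ψ z e = 0 :=
  integral_fderiv_eq_zero hψ.contDiff_one hψ.compact_support e

theorem IsTestFunction.integrable_fderiv_apply (hψ : IsTestFunction O ψ)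
    (e : EuclideanSpace ℝ (Fin n) × ℝ) : Integrable fun z => fderiv ℝ ψ z e :=
  (hψ.continuous_fderiv_apply e).integrable_of_hasCompactSupport
    (hψ.compact_support.fderiv_apply (𝕜 := ℝ) e)

/-- Derivatives of test functions have integral zero, so the weak formulations do not see constants.
-/
theorem integral_add_const_mul_fderiv (hp : 1 ≤ p) (hw : MemLpLoc p O w) (c : ℝ)
    (hψ : IsTestFunction O ψ) (e : EuclideanSpace ℝ (Fin n) × ℝ) :
    ∫ z, (w z + c) * fderiv ℝ ψ z e = ∫ z, w z * fderiv ℝ ψ z e := by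
  simp_rw [add_mul]
  rw [integral_add (hw.integrable_mul_fderiv hp hψ e) ((hψ.integrable_fderiv_apply e).const_mul c),
    integral_const_mul, hψ.integral_fderiv_apply, mul_zero, add_zero]

theorem HasWeakSpatialGrad.add_const (hp : 1 ≤ p) (h : HasWeakSpatialGrad p O w G) (c : ℝ) :
    HasWeakSpatialGrad p O (fun z => w z + c) G :=
  hasWeakSpatialGrad_iff.2 ⟨h.memLp.add_const c, h.grad_memLp, fun ψ hψ e => by
    rw [integral_add_const_mul_fderiv hp h.memLp c hψ, h.integral_eq' hψ]⟩

theorem HasWeakSpatialGrad.weakForm_add_const (hp : 1 < p) (h : HasWeakSpatialGrad p O w G)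
    (c : ℝ) (hψ : IsTestFunction O ψ) :
    weakForm p O (fun z => w z + c) G ψ = weakForm p O w G ψ := by
  rw [(h.add_const hp.le c).weakForm_eq hp hψ, h.weakForm_eq hp hψ,
    integral_add_const_mul_fderiv hp.le h.memLp c hψ]

theorem IsWeakSubsolution.add_const (hp : 1 < p) (h : IsWeakSubsolution p O w) (c : ℝ) :
    IsWeakSubsolution p O fun z => w z + c :=
  let ⟨G, hG, hw⟩ := h
  ⟨G, hG.add_const hp.le c, fun ψ hψ h0 =>
    (hG.weakForm_add_const hp c hψ).trans_le (hw ψ hψ h0)⟩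

theorem IsWeakSupersolution.add_const (hp : 1 < p) (h : IsWeakSupersolution p O w) (c : ℝ) :
    IsWeakSupersolution p O fun z => w z + c :=
  let ⟨G, hG, hw⟩ := h
  ⟨G, hG.add_const hp.le c, fun ψ hψ h0 =>
    (hw ψ hψ h0).trans_eq (hG.weakForm_add_const hp c hψ).symm⟩

theorem MemLpLoc.comp_add_right {F : Type*} [NormedAddCommGroup F]
    {w : EuclideanSpace ℝ (Fin n) × ℝ → F} (h : MemLpLoc p O w)
    (a : EuclideanSpace ℝ (Fin n) × ℝ) :
    MemLpLoc p ((· + a) ⁻¹' O) fun z => w (z + a) := by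
  intro K hKO hK
  have hK' : IsCompact ((· + a) '' K) := hK.image (by fun_prop)
  have hpre : (· + a) ⁻¹' ((· + a) '' K) = K :=
    Set.preimage_image_eq _ (add_left_injective a)
  have hmp := (measurePreserving_add_right volume a).restrict_preimage hK'.measurableSet
  rw [hpre] at hmp
  exact (h _ (Set.image_subset_iff.2 hKO) hK').comp_measurePreserving hmp

theorem IsTestFunction.comp_sub_right {a : EuclideanSpace ℝ (Fin n) × ℝ}
    (hψ : IsTestFunction ((· + a) ⁻¹' O) ψ) : IsTestFunction O fun z => ψ (z - a) := by
  refine ⟨hψ.smooth.comp (contDiff_id.sub contDiff_const),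
    hψ.compact_support.comp_homeomorph (Homeomorph.subRight a), ?_⟩
  have : tsupport (fun z => ψ (z - a)) ⊆ (· - a) ⁻¹' tsupport ψ :=
    closure_minimal (fun z hz => subset_closure hz)
      ((isClosed_tsupport ψ).preimage (by fun_prop))
  refine this.trans fun z hz => ?_
  simpa using hψ.support_subset hz

theorem integral_comp_add_right_mul_fderiv (a e : EuclideanSpace ℝ (Fin n) × ℝ)
    (w ψ : EuclideanSpace ℝ (Fin n) × ℝ → ℝ) :
    ∫ z, w (z + a) * fderiv ℝ ψ z e = ∫ z, w z * fderiv ℝ (fun z => ψ (z - a)) z e := by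
  rw [← integral_add_right_eq_self (fun z => w z * fderiv ℝ (fun z => ψ (z - a)) z e) a]
  simp_rw [fderiv_comp_sub, add_sub_cancel_right]

theorem HasWeakSpatialGrad.comp_add_right (h : HasWeakSpatialGrad p O w G)
    (a : EuclideanSpace ℝ (Fin n) × ℝ) :
    HasWeakSpatialGrad p ((· + a) ⁻¹' O) (fun z => w (z + a)) (fun z => G (z + a)) := by
  refine hasWeakSpatialGrad_iff.2 ⟨h.memLp.comp_add_right a, h.grad_memLp.comp_add_right a,
    fun ψ hψ e => ?_⟩
  rw [integral_comp_add_right_mul_fderiv, h.integral_eq' hψ.comp_sub_right,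
    ← integral_add_right_eq_self (fun z => inner ℝ (G z) e * ψ (z - a)) a]
  simp_rw [add_sub_cancel_right]

theorem HasWeakSpatialGrad.weakForm_comp_add_right (hp : 1 < p) (h : HasWeakSpatialGrad p O w G)
    (a : EuclideanSpace ℝ (Fin n) × ℝ) (hψ : IsTestFunction ((· + a) ⁻¹' O) ψ) :
    weakForm p ((· + a) ⁻¹' O) (fun z => w (z + a)) (fun z => G (z + a)) ψ =
      weakForm p O w G fun z => ψ (z - a) := by
  rw [(h.comp_add_right a).weakForm_eq hp hψ, h.weakForm_eq hp hψ.comp_sub_right,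
    integral_comp_add_right_mul_fderiv]
  congr 1
  exact Finset.sum_congr rfl fun i _ =>
    integral_comp_add_right_mul_fderiv a (spaceDir i) (fun z => pFlux p (G z) i) ψ

theorem IsWeakSubsolution.comp_add_right (hp : 1 < p) (h : IsWeakSubsolution p O w)
    (a : EuclideanSpace ℝ (Fin n) × ℝ) :
    IsWeakSubsolution p ((· + a) ⁻¹' O) fun z => w (z + a) :=
  let ⟨_, hG, hw⟩ := h
  ⟨_, hG.comp_add_right a, fun _ hψ h0 =>
    (hG.weakForm_comp_add_right hp a hψ).trans_le (hw _ hψ.comp_sub_right fun _ => h0 _)⟩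

theorem IsWeakSupersolution.comp_add_right (hp : 1 < p) (h : IsWeakSupersolution p O w)
    (a : EuclideanSpace ℝ (Fin n) × ℝ) :
    IsWeakSupersolution p ((· + a) ⁻¹' O) fun z => w (z + a) :=
  let ⟨_, hG, hw⟩ := h
  ⟨_, hG.comp_add_right a, fun _ hψ h0 =>
    (hw _ hψ.comp_sub_right fun _ => h0 _).trans_eq (hG.weakForm_comp_add_right hp a hψ).symm⟩

end Transformations

/-! ### Barriers: stationary functions plus a linear function of time -/

section Stationary

variable {n : ℕ} {p N c : ℝ} {B : Set (EuclideanSpace ℝ (Fin n))}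
  {g : EuclideanSpace ℝ (Fin n) → ℝ}
  {G : EuclideanSpace ℝ (Fin n) → EuclideanSpace ℝ (Fin n)}
  {ψ : EuclideanSpace ℝ (Fin n) × ℝ → ℝ}

theorem MemLpLoc.comp_fst {F : Type*} [NormedAddCommGroup F] {g : EuclideanSpace ℝ (Fin n) → F}
    (h : MemLpLoc p B g) :
    MemLpLoc p (B ×ˢ Set.univ) fun z : EuclideanSpace ℝ (Fin n) × ℝ => g z.1 := by
  intro K hKO hK
  have h1 : IsCompact (Prod.fst '' K) := hK.image continuous_fst
  have h2 : IsCompact (Prod.snd '' K) := hK.image continuous_snd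
  have hfin : IsFiniteMeasure (volume.restrict (Prod.snd '' K)) :=
    ⟨by rw [Measure.restrict_apply_univ]; exact h2.measure_lt_top⟩
  have h3 := (h _ (by rintro _ ⟨z, hz, rfl⟩; exact (hKO hz).1) h1).comp_fst
    (volume.restrict (Prod.snd '' K))
  rw [Measure.prod_restrict] at h3
  exact h3.mono_measure (Measure.restrict_mono Set.subset_fst_image_prod_snd_image le_rfl)

/-- The stationary weak formulation applies to each time slice of a space-time test function; Fubini
then assembles the slices. -/
theorem IsTestFunction.slice (hψ : IsTestFunction (B ×ˢ Set.univ) ψ) (t : ℝ) :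
    IsTestFunction B fun x => ψ (x, t) := by
  have hsub : tsupport (fun x => ψ (x, t)) ⊆ (fun x => (x, t)) ⁻¹' tsupport ψ :=
    closure_minimal (fun z hz => subset_closure hz)
      ((isClosed_tsupport ψ).preimage (by fun_prop))
  refine ⟨hψ.smooth.comp (contDiff_id.prodMk contDiff_const), ?_, fun x hx =>
    (hψ.support_subset (hsub hx)).1⟩
  refine (hψ.compact_support.isCompact.image continuous_fst).of_isClosed_subset
    (isClosed_tsupport _) fun x hx => ⟨(x, t), hsub hx, rfl⟩

theorem IsTestFunction.fderiv_slice (hψ : IsTestFunction (B ×ˢ Set.univ) ψ) (t : ℝ)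
    (x e : EuclideanSpace ℝ (Fin n)) :
    fderiv ℝ (fun x => ψ (x, t)) x e = fderiv ℝ ψ (x, t) (e, 0) := by
  have h := HasFDerivAt.comp (f := fun x => (x, t)) x (hψ.differentiable (x, t)).hasFDerivAt
    (hasFDerivAt_prodMk_left x t)
  rw [show (fun x => ψ (x, t)) = ψ ∘ fun x => (x, t) from rfl, h.fderiv]
  simp

theorem IsTestFunction.time_mul {O : Set (EuclideanSpace ℝ (Fin n) × ℝ)}
    (hψ : IsTestFunction O ψ) : IsTestFunction O fun z => z.2 * ψ z :=
  ⟨contDiff_snd.mul hψ.smooth, hψ.compact_support.mul_left,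
    (tsupport_mul_subset_right (f := fun z : EuclideanSpace ℝ (Fin n) × ℝ => z.2)).trans
      hψ.support_subset⟩

/-- Integrate the product rule for `t ψ`, whose derivative has integral zero. -/
theorem IsTestFunction.integral_time_mul_fderiv {O : Set (EuclideanSpace ℝ (Fin n) × ℝ)}
    (hψ : IsTestFunction O ψ) (e : EuclideanSpace ℝ (Fin n) × ℝ) :
    ∫ z, z.2 * fderiv ℝ ψ z e = - (e.2 * ∫ z, ψ z) := by
  have h := hψ.time_mul.integral_fderiv_apply e
  have hd : ∀ z, fderiv ℝ (fun z => z.2 * ψ z) z e = z.2 * fderiv ℝ ψ z e + e.2 * ψ z := by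
    intro z
    have h1 := (hasFDerivAt_snd (𝕜 := ℝ) (p := z)).mul (hψ.differentiable z).hasFDerivAt
    rw [show (fun z => z.2 * ψ z) = Prod.snd * ψ from rfl, h1.fderiv]
    simp [mul_comm]
  simp_rw [hd] at h
  have hψi : Integrable ψ := hψ.smooth.continuous.integrable_of_hasCompactSupport
    hψ.compact_support
  have hti : Integrable fun z => z.2 * fderiv ℝ ψ z e :=
    (continuous_snd.mul (hψ.continuous_fderiv_apply e)).integrable_of_hasCompactSupport
      (hψ.compact_support.fderiv_apply (𝕜 := ℝ) e).mul_left
  rw [integral_add hti (hψi.const_mul _), integral_const_mul] at h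
  linarith

theorem MemLpLoc.time {O : Set (EuclideanSpace ℝ (Fin n) × ℝ)} (c : ℝ) :
    MemLpLoc p O fun z : EuclideanSpace ℝ (Fin n) × ℝ => c * z.2 := by
  intro K _ hK
  have : IsFiniteMeasure (volume.restrict K) :=
    ⟨by rw [Measure.restrict_apply_univ]; exact hK.measure_lt_top⟩
  have hc : Continuous fun z : EuclideanSpace ℝ (Fin n) × ℝ => c * z.2 := by fun_prop
  obtain ⟨C, hC⟩ := hK.exists_bound_of_continuousOn hc.continuousOn
  exact MemLp.of_bound hc.aestronglyMeasurable C
    (ae_restrict_of_forall_mem hK.measurableSet hC)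

theorem MemLpLoc.integral_add_time_mul_fderiv (hp : 1 ≤ p) (hg : MemLpLoc p B g) (c : ℝ)
    (hψ : IsTestFunction (B ×ˢ Set.univ) ψ) (e : EuclideanSpace ℝ (Fin n) × ℝ) :
    ∫ z, (g z.1 + c * z.2) * fderiv ℝ ψ z e =
      (∫ z : EuclideanSpace ℝ (Fin n) × ℝ, g z.1 * fderiv ℝ ψ z e) - c * (e.2 * ∫ z, ψ z) := by
  simp_rw [add_mul]
  rw [integral_add (hg.comp_fst.integrable_mul_fderiv hp hψ e)
    ((MemLpLoc.time c).integrable_mul_fderiv hp hψ e)]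
  simp_rw [mul_assoc]
  rw [integral_const_mul, hψ.integral_time_mul_fderiv]
  ring

theorem HasWeakGrad.integral_slice (h : HasWeakGrad p B g G)
    (hψ : IsTestFunction (B ×ˢ Set.univ) ψ) (e : EuclideanSpace ℝ (Fin n)) (t : ℝ) :
    ∫ x, g x * fderiv ℝ ψ (x, t) (e, 0) = - ∫ x, inner ℝ (G x) e * ψ (x, t) := by
  have h1 := h.integral_eq _ (hψ.slice t) e
  rw [setIntegral_eq_integral_of_forall_compl_eq_zero fun x hx => by
    rw [(hψ.slice t).fderiv_eq_zero hx]; simp,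
    setIntegral_eq_integral_of_forall_compl_eq_zero fun x hx => by
    rw [(hψ.slice t).eq_zero hx, mul_zero]] at h1
  simpa only [hψ.fderiv_slice] using h1

theorem HasWeakGrad.hasWeakSpatialGrad_add_time (hp : 1 ≤ p) (h : HasWeakGrad p B g G) (c : ℝ) :
    HasWeakSpatialGrad p (B ×ˢ Set.univ) (fun z => g z.1 + c * z.2) fun z => G z.1 := by
  refine hasWeakSpatialGrad_iff.2 ⟨fun K hKO hK => ?_, h.grad_memLp.comp_fst, fun ψ hψ e => ?_⟩
  · exact (h.memLp.comp_fst K hKO hK).add (MemLpLoc.time c K hKO hK)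
  · have hGi : Integrable fun z : EuclideanSpace ℝ (Fin n) × ℝ => inner ℝ (G z.1) e * ψ z := by
      refine MemLpLoc.integrable_mul hp (O := B ×ˢ Set.univ) (fun K hKO hK => ?_)
        hψ.smooth.continuous hψ.compact_support hψ.support_subset
      exact (h.grad_memLp.comp_fst K hKO hK).inner_const e
    rw [h.memLp.integral_add_time_mul_fderiv hp c hψ, zero_mul, mul_zero, sub_zero,
      Measure.volume_eq_prod, integral_prod_symm _
        (h.memLp.comp_fst.integrable_mul_fderiv hp hψ (e, 0)), integral_prod_symm _ hGi]
    simp_rw [h.integral_slice hψ, integral_neg]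

/-- By Fubini: for fixed `x` the factor `g x` is constant and the time integral of `ψ_t` vanishes.
-/
theorem MemLpLoc.integral_mul_time_deriv (hp : 1 ≤ p) (hg : MemLpLoc p B g)
    (hψ : IsTestFunction (B ×ˢ Set.univ) ψ) :
    ∫ z : EuclideanSpace ℝ (Fin n) × ℝ, g z.1 * fderiv ℝ ψ z (0, 1) = 0 := by
  rw [Measure.volume_eq_prod, integral_prod _ (hg.comp_fst.integrable_mul_fderiv hp hψ (0, 1))]
  refine integral_eq_zero_of_ae (.of_forall fun x => ?_)
  have hC : ContDiff ℝ 1 fun t => ψ (x, t) :=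
    hψ.contDiff_one.comp (contDiff_const.prodMk contDiff_id)
  have hc : HasCompactSupport fun t => ψ (x, t) := by
    refine (hψ.compact_support.isCompact.image continuous_snd).of_isClosed_subset
      (isClosed_tsupport _) fun t ht => ⟨(x, t), ?_, rfl⟩
    have hsub : tsupport (fun t => ψ (x, t)) ⊆ (fun t => (x, t)) ⁻¹' tsupport ψ :=
      closure_minimal (fun z hz => subset_closure hz)
        ((isClosed_tsupport ψ).preimage (by fun_prop))
    exact hsub ht
  have hd : ∀ t, fderiv ℝ (fun t => ψ (x, t)) t 1 = fderiv ℝ ψ (x, t) (0, 1) := fun t => by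
    have h := HasFDerivAt.comp (f := fun t => (x, t)) t (hψ.differentiable (x, t)).hasFDerivAt
      (hasFDerivAt_prodMk_right x t)
    rw [show (fun t => ψ (x, t)) = ψ ∘ fun t => (x, t) from rfl, h.fderiv]
    simp
  have h0 := integral_fderiv_eq_zero (μ := volume) hC hc 1
  simp_rw [hd] at h0
  simp only [Pi.zero_apply]
  rw [integral_const_mul, h0, mul_zero]

theorem HasWeakGrad.weakForm_add_time (hp : 1 < p) (h : HasWeakGrad p B g G) (c : ℝ)
    (hψ : IsTestFunction (B ×ˢ Set.univ) ψ) :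
    weakForm p (B ×ˢ Set.univ) (fun z => g z.1 + c * z.2) (fun z => G z.1) ψ =
      ∫ t, ((∫ x in B, fderiv ℝ (fun x => ψ (x, t)) x (pFlux p (G x))) +
        ∫ x, c * ψ (x, t)) := by
  have hG := h.hasWeakSpatialGrad_add_time hp.le c
  have hψi : Integrable ψ := hψ.smooth.continuous.integrable_of_hasCompactSupport
    hψ.compact_support
  have hAi := hG.integrable_fderiv_pFlux hp hψ
  have hsl : ∀ t, ∫ x in B, fderiv ℝ (fun x => ψ (x, t)) x (pFlux p (G x)) =
      ∫ x, fderiv ℝ ψ (x, t) (pFlux p (G x), 0) := fun t => by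
    rw [setIntegral_eq_integral_of_forall_compl_eq_zero fun x hx => by
      rw [(hψ.slice t).fderiv_eq_zero hx]; simp]
    simp_rw [hψ.fderiv_slice]
  rw [weakForm_eq_integral hψ, integral_sub hAi (hG.memLp.integrable_mul_fderiv hp.le hψ _),
    h.memLp.integral_add_time_mul_fderiv hp.le c hψ, h.memLp.integral_mul_time_deriv hp.le hψ]
  simp_rw [hsl]
  have hci : Integrable fun z => c * ψ z := hψi.const_mul c
  rw [integral_add hAi.integral_prod_right hci.integral_prod_right,
    ← integral_prod_symm _ hAi, ← integral_prod_symm _ hci, ← Measure.volume_eq_prod,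
    integral_const_mul]
  ring

theorem integral_abs_mul_le {μ : Measure (EuclideanSpace ℝ (Fin n))}
    {H η : EuclideanSpace ℝ (Fin n) → ℝ}
    (hN : ∀ᵐ x ∂(μ.restrict B), |H x| ≤ N) (hη : Integrable η μ) (hη0 : ∀ x, 0 ≤ η x)
    (hN0 : 0 ≤ N) : |∫ x in B, H x * η x ∂μ| ≤ ∫ x, N * η x ∂μ := by
  calc |∫ x in B, H x * η x ∂μ| ≤ ∫ x in B, N * η x ∂μ := by
        refine norm_integral_le_of_norm_le (f := fun x => H x * η x)
          (hη.const_mul N).integrableOn ?_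
        filter_upwards [hN] with x hx
        rw [norm_mul, Real.norm_eq_abs, Real.norm_of_nonneg (hη0 x)]
        exact mul_le_mul_of_nonneg_right hx (hη0 x)
    _ ≤ ∫ x, N * η x ∂μ :=
        setIntegral_le_integral (hη.const_mul N) (.of_forall fun x => mul_nonneg hN0 (hη0 x))

/-- `Δ_p g ≤ N`, and `N` is the time derivative of the barrier. In the weak form, the `N ψ` produced
by the linear term dominates `H ψ` on every slice. -/
theorem PLaplacianAbsLe.isWeakSupersolution (hp : 1 < p) (hN : 0 ≤ N)
    (h : PLaplacianAbsLe p N B g) :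
    IsWeakSupersolution p (B ×ˢ Set.univ) fun z => g z.1 + N * z.2 := by
  obtain ⟨G, H, hG, -, hHN, hH⟩ := h
  refine ⟨_, hG.hasWeakSpatialGrad_add_time hp.le N, fun ψ hψ h0 => ?_⟩
  rw [hG.weakForm_add_time hp N hψ]
  refine integral_nonneg fun t => ?_
  have hs := hψ.slice t
  have h1 := integral_abs_mul_le hHN (hs.smooth.continuous.integrable_of_hasCompactSupport
    hs.compact_support) (fun x => h0 _) hN
  simp only [Pi.zero_apply]
  rw [hH _ hs]
  linarith [(abs_le.1 h1).2]

theorem PLaplacianAbsLe.isWeakSubsolution (hp : 1 < p) (hN : 0 ≤ N)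
    (h : PLaplacianAbsLe p N B g) :
    IsWeakSubsolution p (B ×ˢ Set.univ) fun z => g z.1 + -N * z.2 := by
  obtain ⟨G, H, hG, -, hHN, hH⟩ := h
  refine ⟨_, hG.hasWeakSpatialGrad_add_time hp.le (-N), fun ψ hψ h0 => ?_⟩
  rw [hG.weakForm_add_time hp (-N) hψ]
  refine integral_nonpos fun t => ?_
  have hs := hψ.slice t
  have h1 := integral_abs_mul_le hHN (hs.smooth.continuous.integrable_of_hasCompactSupport
    hs.compact_support) (fun x => h0 _) hN
  simp only [Pi.zero_apply]
  rw [hH _ hs]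
  simp_rw [neg_mul, integral_neg]
  linarith [(abs_le.1 h1).1]

end Stationary

/-! ### Time regularity for the obstacle problem -/

section ObstacleProblem

variable {n : ℕ} {p N : ℝ}

theorem HasWeakGrad.congr {B : Set (EuclideanSpace ℝ (Fin n))} (hB : MeasurableSet B)
    {g g' : EuclideanSpace ℝ (Fin n) → ℝ}
    {G : EuclideanSpace ℝ (Fin n) → EuclideanSpace ℝ (Fin n)} (h : HasWeakGrad p B g G)
    (hg : ∀ x ∈ B, g x = g' x) : HasWeakGrad p B g' G := by
  refine ⟨fun K hKB hK => (h.memLp K hKB hK).ae_eq ?_, h.grad_memLp, fun ψ hψ e => ?_⟩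
  · exact ae_restrict_of_forall_mem hK.measurableSet fun x hx => hg x (hKB hx)
  · rw [← h.integral_eq ψ hψ e]
    exact setIntegral_congr_fun hB fun x hx => by simp only [hg x hx]

theorem PLaplacianAbsLe.congr {B : Set (EuclideanSpace ℝ (Fin n))} (hB : MeasurableSet B)
    {g g' : EuclideanSpace ℝ (Fin n) → ℝ} (h : PLaplacianAbsLe p N B g)
    (hg : ∀ x ∈ B, g x = g' x) : PLaplacianAbsLe p N B g' :=
  let ⟨G, H, hG, hH⟩ := h
  ⟨G, H, hG.congr hB hg, hH⟩

variable {φ f : EuclideanSpace ℝ (Fin n) × ℝ → ℝ} {g : EuclideanSpace ℝ (Fin n) → ℝ}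
  {u : EuclideanSpace ℝ (Fin n) × ℝ → ℝ}

/-- The Lipschitz bounds on `f` and `φ` hold only for positive times; this limit carries their
consequences for `u` down to `t = 0`. -/
theorem IsObstacleSolution.tendsto_initial (hu : IsObstacleSolution p φ f g u)
    {x : EuclideanSpace ℝ (Fin n)} (hx : x ∈ closedBall (0 : EuclideanSpace ℝ (Fin n)) 1) :
    Tendsto (fun s => u (x, s)) (𝓝[>] 0) (𝓝 (u (x, 0))) := by
  have hc : ContinuousOn (fun s => u (x, s)) (Set.Ico 0 1) :=
    hu.continuousOn.comp (by fun_prop) fun s hs => ⟨hx, hs⟩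
  have := (hc 0 ⟨le_rfl, one_pos⟩).mono Set.Ioo_subset_Ico_self
  rwa [ContinuousWithinAt, nhdsWithin_Ioo_eq_nhdsGT one_pos] at this

/-- Let `s → 0` in `φ(x, t) ≤ φ(x, s) + N (t - s) ≤ u(x, s) + N (t - s)`. It shows that the upper
barrier stays above the obstacle. -/
theorem IsObstacleSolution.obstacle_le_initial_add (hu : IsObstacleSolution p φ f g u)
    (hφt : TimeDerivAbsLe N (ball 0 1) (Set.Ioo 0 1) φ)
    {x : EuclideanSpace ℝ (Fin n)} (hx : x ∈ ball (0 : EuclideanSpace ℝ (Fin n)) 1)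
    {t : ℝ} (ht : t ∈ Set.Ioo (0 : ℝ) 1) : φ (x, t) ≤ u (x, 0) + N * t := by
  have hlim : Tendsto (fun s => u (x, s) + N * (t - s)) (𝓝[>] 0) (𝓝 (u (x, 0) + N * (t - 0))) :=
    (hu.tendsto_initial (ball_subset_closedBall hx)).add
      ((tendsto_const_nhds.mul (tendsto_const_nhds.sub tendsto_id)).mono_left nhdsWithin_le_nhds)
  rw [sub_zero] at hlim
  refine ge_of_tendsto hlim ?_
  filter_upwards [Ioo_mem_nhdsGT ht.1] with s hs
  have hs' : s ∈ Set.Ioo (0 : ℝ) 1 := ⟨hs.1, hs.2.trans ht.2⟩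
  have h1 := hφt x hx s hs' t ht
  rw [abs_of_pos (sub_pos.2 hs.2)] at h1
  linarith [(abs_le.1 h1).2, hu.obstacle_le (x, s) ⟨hx, hs'⟩]

theorem IsObstacleSolution.abs_sub_le_of_mem_sphere (hu : IsObstacleSolution p φ f g u)
    (hft : TimeDerivAbsLe N (sphere 0 1) (Set.Ioo 0 1) f)
    {x : EuclideanSpace ℝ (Fin n)} (hx : x ∈ sphere (0 : EuclideanSpace ℝ (Fin n)) 1)
    {s t : ℝ} (hs : s ∈ Set.Ioo (0 : ℝ) 1) (ht : t ∈ Set.Ioo (0 : ℝ) 1) :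
    |u (x, t) - u (x, s)| ≤ N * |t - s| := by
  rw [hu.lateral x hx s hs, hu.lateral x hx t ht]
  exact hft x hx s hs t ht

theorem IsObstacleSolution.abs_sub_initial_le_of_mem_sphere (hu : IsObstacleSolution p φ f g u)
    (hft : TimeDerivAbsLe N (sphere 0 1) (Set.Ioo 0 1) f)
    {x : EuclideanSpace ℝ (Fin n)} (hx : x ∈ sphere (0 : EuclideanSpace ℝ (Fin n)) 1)
    {t : ℝ} (ht : t ∈ Set.Ioo (0 : ℝ) 1) : |u (x, t) - u (x, 0)| ≤ N * t := by
  have hlim : Tendsto (fun s => |u (x, t) - u (x, s)|) (𝓝[>] 0) (𝓝 |u (x, t) - u (x, 0)|) :=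
    (tendsto_const_nhds.sub (hu.tendsto_initial (sphere_subset_closedBall hx))).abs
  have hlim' : Tendsto (fun s => N * |t - s|) (𝓝[>] 0) (𝓝 (N * |t - 0|)) := by
    refine (Continuous.tendsto ?_ 0).mono_left nhdsWithin_le_nhds
    fun_prop
  rw [sub_zero, abs_of_pos ht.1] at hlim'
  refine le_of_tendsto_of_tendsto hlim hlim' ?_
  filter_upwards [Ioo_mem_nhdsGT ht.1] with s hs
  exact hu.abs_sub_le_of_mem_sphere hft hx ⟨hs.1, hs.2.trans ht.2⟩ ht

/-- The barriers are built from `u(·, 0)` rather than `g`: the two agree on the open ball, but only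
the former is known to be continuous up to the sphere. -/
theorem IsObstacleSolution.continuousOn_initial_add (hu : IsObstacleSolution p φ f g u) (c : ℝ) :
    ContinuousOn (fun z : EuclideanSpace ℝ (Fin n) × ℝ => u (z.1, 0) + c * z.2)
      (closedBall 0 1 ×ˢ Set.Ico 0 1) := by
  refine ContinuousOn.add (hu.continuousOn.comp (by fun_prop) fun z hz => ?_) (by fun_prop)
  exact ⟨hz.1, le_rfl, one_pos⟩

/-- Where `u` exceeds the upper barrier it also exceeds `φ`, hence is a solution there and may be
compared with a supersolution. The lower barrier is a subsolution, and `u` is a supersolution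
everywhere. -/
theorem IsObstacleSolution.abs_sub_initial_le (hp : 1 < p) (hN : 0 ≤ N)
    (hu : IsObstacleSolution p φ f g u)
    (hft : TimeDerivAbsLe N (sphere 0 1) (Set.Ioo 0 1) f)
    (hφt : TimeDerivAbsLe N (ball 0 1) (Set.Ioo 0 1) φ)
    (hg : PLaplacianAbsLe p N (ball 0 1) g) :
    ∀ z ∈ closedBall (0 : EuclideanSpace ℝ (Fin n)) 1 ×ˢ Set.Ico 0 1,
      |u z - u (z.1, 0)| ≤ N * z.2 := by
  have hg' : PLaplacianAbsLe p N (ball 0 1) fun x => u (x, 0) :=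
    hg.congr measurableSet_ball fun x hx => (hu.initial x hx).symm
  have hupper := comparison hp (T := 1) hu.continuousOn (hu.continuousOn_initial_add N)
    (fun x _ => by simp)
    (fun x hx t ht => by
      linarith [(abs_le.1 (hu.abs_sub_initial_le_of_mem_sphere hft hx ht)).2])
    (hu.solution_off_contact.isWeakSubsolution.mono fun z hz =>
      ⟨hz.1, (hu.obstacle_le_initial_add hφt hz.1.1 hz.1.2).trans_lt hz.2⟩)
    ((hg'.isWeakSupersolution hp hN).mono fun z hz => ⟨hz.1.1, Set.mem_univ _⟩)
  have hlower := comparison hp (T := 1) (hu.continuousOn_initial_add (-N)) hu.continuousOn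
    (fun x _ => by simp)
    (fun x hx t ht => by
      linarith [(abs_le.1 (hu.abs_sub_initial_le_of_mem_sphere hft hx ht)).1])
    ((hg'.isWeakSubsolution hp hN).mono fun z hz => ⟨hz.1.1, Set.mem_univ _⟩)
    (hu.supersolution.mono fun z hz => hz.1)
  intro z hz
  rw [abs_le]
  constructor <;> linarith [hupper z hz, hlower z hz]

/-- Two comparisons on the cylinder of height `1 - h`, with `u` and its shifted translate exchanging
roles. In each, the larger function is strictly above its own obstacle on the set of violation,
because the other function lies above an obstacle that differs from it by at most `N h`. The order
at time `0` is `abs_sub_initial_le` at time `h`. -/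
theorem IsObstacleSolution.abs_translate_sub_le (hp : 1 < p) (hN : 0 ≤ N)
    (hu : IsObstacleSolution p φ f g u)
    (hft : TimeDerivAbsLe N (sphere 0 1) (Set.Ioo 0 1) f)
    (hφt : TimeDerivAbsLe N (ball 0 1) (Set.Ioo 0 1) φ)
    (hg : PLaplacianAbsLe p N (ball 0 1) g) {h : ℝ} (hh : h ∈ Set.Ioo (0 : ℝ) 1) :
    ∀ z ∈ closedBall (0 : EuclideanSpace ℝ (Fin n)) 1 ×ˢ Set.Ico 0 (1 - h),
      |u (z + (0, h)) - u z| ≤ N * h := by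
  have hinit := hu.abs_sub_initial_le hp hN hft hφt hg
  have hadd : ∀ (x : EuclideanSpace ℝ (Fin n)) (t : ℝ), (x, t) + (0, h) = (x, t + h) :=
    fun x t => by simp
  have hshift : ∀ {t : ℝ}, t ∈ Set.Ioo 0 (1 - h) → t ∈ Set.Ioo (0 : ℝ) 1 ∧
      t + h ∈ Set.Ioo (0 : ℝ) 1 := fun ht =>
    ⟨⟨ht.1, by linarith [ht.2, hh.1]⟩, by linarith [ht.1, hh.1], by linarith [ht.2]⟩
  have huc : ContinuousOn u (closedBall 0 1 ×ˢ Set.Ico 0 (1 - h)) :=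
    hu.continuousOn.mono (Set.prod_mono le_rfl (Set.Ico_subset_Ico_right (by linarith [hh.1])))
  have huhc : ∀ c : ℝ, ContinuousOn (fun z => u (z + (0, h)) + c)
      (closedBall 0 1 ×ˢ Set.Ico 0 (1 - h)) := fun c =>
    (hu.continuousOn.comp (by fun_prop) fun z hz => by
      refine ⟨by simpa using hz.1, ?_, ?_⟩
      · simpa using add_nonneg hz.2.1 hh.1.le
      · have := hz.2.2
        simp only [Prod.snd_add]
        linarith).add continuousOn_const
  have h0 : ∀ x ∈ closedBall (0 : EuclideanSpace ℝ (Fin n)) 1,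
      |u ((x, 0) + (0, h)) - u (x, 0)| ≤ N * h := fun x hx => by
    rw [hadd, zero_add]
    exact hinit (x, h) ⟨hx, Set.Ioo_subset_Ico_self hh⟩
  have hl : ∀ x ∈ sphere (0 : EuclideanSpace ℝ (Fin n)) 1, ∀ t ∈ Set.Ioo 0 (1 - h),
      |u ((x, t) + (0, h)) - u (x, t)| ≤ N * h := fun x hx t ht => by
    rw [hadd]
    have := hu.abs_sub_le_of_mem_sphere hft hx (hshift ht).1 (hshift ht).2
    rwa [add_sub_cancel_left, abs_of_pos hh.1] at this
  have hφh : ∀ z ∈ ball (0 : EuclideanSpace ℝ (Fin n)) 1 ×ˢ Set.Ioo 0 (1 - h),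
      |φ (z + (0, h)) - φ z| ≤ N * h := fun ⟨x, t⟩ hz => by
    rw [hadd]
    have := hφt x hz.1 t (hshift hz.2).1 (t + h) (hshift hz.2).2
    rwa [add_sub_cancel_left, abs_of_pos hh.1] at this
  have hmem : ∀ z ∈ ball (0 : EuclideanSpace ℝ (Fin n)) 1 ×ˢ Set.Ioo 0 (1 - h),
      z ∈ cylinder n ∧ z + (0, h) ∈ cylinder n := fun ⟨x, t⟩ hz => by
    rw [hadd]
    exact ⟨⟨hz.1, (hshift hz.2).1⟩, hz.1, (hshift hz.2).2⟩
  have hupper := comparison hp (T := 1 - h) (huhc (-(N * h))) huc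
    (fun x hx => by linarith [(abs_le.1 (h0 x hx)).2])
    (fun x hx t ht => by linarith [(abs_le.1 (hl x hx t ht)).2])
    (((hu.solution_off_contact.isWeakSubsolution.comp_add_right hp (0, h)).add_const hp
      (-(N * h))).mono fun z hz => ⟨(hmem z hz.1).2, by
        have h1 := (abs_le.1 (hφh z hz.1)).2
        have h2 := hu.obstacle_le z (hmem z hz.1).1
        have h3 : u z < u (z + (0, h)) + -(N * h) := hz.2
        change φ (z + (0, h)) < u (z + (0, h))
        linarith⟩)
    (hu.supersolution.mono fun z hz => (hmem z hz.1).1)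
  have hlower := comparison hp (T := 1 - h) huc (huhc (N * h))
    (fun x hx => by linarith [(abs_le.1 (h0 x hx)).1])
    (fun x hx t ht => by linarith [(abs_le.1 (hl x hx t ht)).1])
    (hu.solution_off_contact.isWeakSubsolution.mono fun z hz => ⟨(hmem z hz.1).1, by
        have h1 := (abs_le.1 (hφh z hz.1)).1
        have h2 := hu.obstacle_le _ (hmem z hz.1).2
        have h3 : u (z + (0, h)) + N * h < u z := hz.2
        linarith⟩)
    (((hu.supersolution.comp_add_right hp (0, h)).add_const hp (N * h)).mono fun z hz =>
      (hmem z hz.1).2)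
  intro z hz
  rw [abs_le]
  constructor <;> linarith [hupper z hz, hlower z hz]

theorem IsObstacleSolution.timeDerivAbsLe (hp : 1 < p) (hN : 0 ≤ N)
    (hu : IsObstacleSolution p φ f g u)
    (hft : TimeDerivAbsLe N (sphere 0 1) (Set.Ioo 0 1) f)
    (hφt : TimeDerivAbsLe N (ball 0 1) (Set.Ioo 0 1) φ)
    (hg : PLaplacianAbsLe p N (ball 0 1) g) :
    TimeDerivAbsLe N (ball 0 1) (Set.Ico 0 1) u := by
  have key : ∀ x ∈ ball (0 : EuclideanSpace ℝ (Fin n)) 1, ∀ s ∈ Set.Ico (0 : ℝ) 1,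
      ∀ t ∈ Set.Ico (0 : ℝ) 1, s < t → |u (x, t) - u (x, s)| ≤ N * |t - s| := by
    intro x hx s hs t ht hst
    have := hu.abs_translate_sub_le hp hN hft hφt hg (h := t - s)
      ⟨sub_pos.2 hst, by linarith [hs.1, ht.2]⟩ (x, s)
      ⟨ball_subset_closedBall hx, hs.1, by linarith [ht.2]⟩
    rw [abs_of_pos (sub_pos.2 hst)]
    simpa using this
  intro x hx s hs t ht
  rcases lt_trichotomy s t with h | h | h
  · exact key x hx s hs t ht h
  · simp [h]
  · rw [abs_sub_comm, abs_sub_comm t s]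
    exact key x hx t ht s hs h

/-- One-dimensional Rademacher theorem; the Lipschitz constant bounds the derivative wherever it
exists. -/
theorem TimeDerivAbsLe.ae_differentiableAt (hN : 0 ≤ N) {S : Set (EuclideanSpace ℝ (Fin n))}
    {a b : ℝ} {w : EuclideanSpace ℝ (Fin n) × ℝ → ℝ} (hw : TimeDerivAbsLe N S (Set.Ioo a b) w)
    {x : EuclideanSpace ℝ (Fin n)} (hx : x ∈ S) :
    ∀ᵐ t ∂(volume.restrict (Set.Ioo a b)),
      DifferentiableAt ℝ (fun s => w (x, s)) t ∧ |deriv (fun s => w (x, s)) t| ≤ N := by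
  have hlip : LipschitzOnWith N.toNNReal (fun s => w (x, s)) (Set.Ioo a b) :=
    LipschitzOnWith.of_dist_le_mul fun t ht s hs => by
      rw [Real.coe_toNNReal N hN, Real.dist_eq, Real.dist_eq]
      exact hw x hx s hs t ht
  filter_upwards [hlip.ae_differentiableWithinAt_real measurableSet_Ioo,
    ae_restrict_mem measurableSet_Ioo] with t hd ht
  refine ⟨hd.differentiableAt (isOpen_Ioo.mem_nhds ht), ?_⟩
  refine norm_deriv_le_of_lip' (f := fun s => w (x, s)) hN ?_
  filter_upwards [isOpen_Ioo.mem_nhds ht] with s hs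
  exact hw x hx t ht s hs

end ObstacleProblem

end PObstacle

end

theorem lemma6 (n : ℕ) (hn : 2 ≤ n) (p : ℝ) (hp : 1 < p) (N : ℝ) (hN : 0 < N)
    (φ f : EuclideanSpace ℝ (Fin n) × ℝ → ℝ) (g : EuclideanSpace ℝ (Fin n) → ℝ)
    (u : EuclideanSpace ℝ (Fin n) × ℝ → ℝ)
    (hφ : ContinuousOn φ (PObstacle.cylinder n))
    (hu : PObstacle.IsObstacleSolution p φ f g u)
    (hft : PObstacle.TimeDerivAbsLe N (Metric.sphere 0 1) (Set.Ioo 0 1) f)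
    (hφt : PObstacle.TimeDerivAbsLe N (Metric.ball 0 1) (Set.Ioo 0 1) φ)
    (hg : PObstacle.PLaplacianAbsLe p N (Metric.ball 0 1) g) :
    PObstacle.TimeDerivAbsLe N (Metric.ball 0 1) (Set.Ico 0 1) u ∧
      ∀ x ∈ Metric.ball (0 : EuclideanSpace ℝ (Fin n)) 1,
        ∀ᵐ t ∂(volume.restrict (Set.Ioo (0 : ℝ) 1)),
          DifferentiableAt ℝ (fun s => u (x, s)) t ∧ |deriv (fun s => u (x, s)) t| ≤ N := by
  have hlip := hu.timeDerivAbsLe hp hN.le hft hφt hg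
  have hlip' : PObstacle.TimeDerivAbsLe N (Metric.ball 0 1) (Set.Ioo 0 1) u :=
    fun x hx s hs t ht =>
      hlip x hx s (Set.Ioo_subset_Ico_self hs) t (Set.Ioo_subset_Ico_self ht)
  exact ⟨hlip, fun x hx => hlip'.ae_differentiableAt hN.le hx⟩
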